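/- Let $n,m\ge 1$ be integers. In $\mathbb{R}^n$ consider the arrangements $$\mathcal{A}_n^{(m)}=\{x_i=0 : i\in[n]\}\cup\{x_i=2^kx_j : k\in[-m,m],\ 1\le i<j\le n\},\qquad \mathcal{B}_n^{(m)}=\{x_i=2^kx_j : k\in[0,m],\ i,j\in[n],\ i\ne j\}.$$ The regions of an arrangement are the connected components of the complement of the union of its hyperplanes, and $r(\cdot)$ denotes their number. For integers $\ell\ge 0$ and $r\ge 1$ let $A_\ell(m,r)=\frac{r}{\ell(m+1)+r}\binom{\ell(m+1)+r}{\ell}$. A decorated $m$-non-nesting partition of size $n$ is an ordered pair $(\Pi_1,\Pi_2)$ of (possibly empty) non-nesting partitions of initial segments $[N_1]$, $[N_2]$, all of whose blocks have size $m+1$, with $n$ blocks in total, which carry distinct labels from $[n]$. (Non-nesting: if arcs join consecutive elements of each block, no arc is nested inside another.) Its arc diagram is the labeled diagram of $\Pi_1$, followed by a red line, followed by that of $\Pi_2$, each dot being replaced by the label of its block. A block is isolated if its $m+1$ points are consecutive, and tangled otherwise. To such a partition one associates the set of points $x\in\mathbb{R}^n$ for which the numbers $0$ and $2^kx_i$ ($i\in[n]$,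 $k\in[0,m]$) are strictly increasing when read along the diagram as follows: the red line stands for $0$; the successive occurrences of a label $i$ after the red line stand for $x_i,2x_i,\dots,2^mx_i$; the successive occurrences of a label $i$ before the red line stand for $2^mx_i,\dots,2x_i,x_i$. This is a bijection from the decorated $m$-non-nesting partitions of size $n$ onto the regions of $\mathcal{A}_n^{(m)}$, by which the two are identified. Two decorated $m$-non-nesting partitions of size $n$ lie in the same region of $\mathcal{B}_n^{(m)}$ if and only if 1. they differ at most by the position of the red line (their labeled arc diagrams coincide once the red line is deleted), and 2. every tangled block is on the same side of the red line in both. Moreover, $$r(\mathcal{B}_n^{(m)})=n!\cdot\bigl(A_n(m,2)-A_{n-1}(m,2)\bigr).$$ -/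

import Mathlib

/-! ### Hyperplane arrangements and their regions -/

/-- The regions of an arrangement in `ℝⁿ` (given as its set of hyperplanes): the connected
components of the complement of the union of the hyperplanes. -/
def regions {n : ℕ} (H : Set (Set (Fin n → ℝ))) : Set (Set (Fin n → ℝ)) :=
  {R | ∃ x ∈ (⋃₀ H)ᶜ, R = connectedComponentIn (⋃₀ H)ᶜ x}

/-- The arrangement `{x_i = 0} ∪ {x_i = 2^k x_j : k ∈ [-m, m], i < j}` in `ℝⁿ`. -/
def arrangementA (n m : ℕ) : Set (Set (Fin n → ℝ)) :=
  {P | ∃ i : Fin n, P = {x | x i = 0}} ∪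
  {P | ∃ i j : Fin n, i < j ∧ ∃ k : ℤ, -(m : ℤ) ≤ k ∧ k ≤ (m : ℤ) ∧
    P = {x | x i = (2 : ℝ) ^ k * x j}}

/-- The arrangement `{x_i = 2^k x_j : k ∈ [0, m], i ≠ j}` in `ℝⁿ`. -/
def arrangementB (n m : ℕ) : Set (Set (Fin n → ℝ)) :=
  {P | ∃ i j : Fin n, i ≠ j ∧ ∃ k : ℕ, k ≤ m ∧ P = {x | x i = (2 : ℝ) ^ k * x j}}

/-- The two parameter Fuss-Catalan (Raney) number
`A_n(m, r) = r / (n (m + 1) + r) * binom (n (m + 1) + r) n`. -/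
def raney (n m r : ℕ) : ℚ :=
  (r : ℚ) / ((n * (m + 1) + r : ℕ) : ℚ) * (Nat.choose (n * (m + 1) + r) n : ℚ)

/-! ### Decorated non-nesting partitions

A partition of `{0, …, N - 1}` whose blocks carry distinct labels from `[n]` is recorded by its
labeled arc diagram, that is, by the word of length `N` whose letter at place `p` is the label of
the block containing `p`. The block labeled `i` is the set of places of the letter `i`. -/

/-- There is an arc from place `p` to place `q` in the diagram of `w`: they are consecutive
elements of one block. -/
def IsArc {n : ℕ} (w : List (Fin n)) (p q : ℕ) : Prop :=
  p < q ∧ ∃ i : Fin n, w[p]? = some i ∧ w[q]? = some i ∧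
    ∀ r : ℕ, p < r → r < q → w[r]? ≠ some i

/-- No arc of the diagram of `w` is nested inside another one. -/
def NonNesting {n : ℕ} (w : List (Fin n)) : Prop :=
  ∀ p q p' q' : ℕ, IsArc w p q → IsArc w p' q' → ¬ (p < p' ∧ q' < q)

/-- A decorated `m`-non-nesting partition of size `n`: an ordered pair of (possibly empty) labeled
non-nesting partitions, all of whose blocks have `m + 1` elements, with `n` blocks altogether,
which carry distinct labels from `[n]` (so each label names one block, of one of the two
partitions). The red line stands between `left` and `right`. -/
structure DecoratedPartition (n m : ℕ) where
  left : List (Fin n)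
  right : List (Fin n)
  nonNesting_left : NonNesting left
  nonNesting_right : NonNesting right
  blocks : ∀ i : Fin n, (left.count i = m + 1 ∧ right.count i = 0) ∨
    (left.count i = 0 ∧ right.count i = m + 1)

namespace DecoratedPartition

variable {n m : ℕ}

/-- The labeled arc diagram with the red line deleted. -/
def diagram (D : DecoratedPartition n m) : List (Fin n) := D.left ++ D.right

/-- The block labeled `i` is isolated: its `m + 1` points are consecutive. (The red line never
separates two points of one block.) -/
def Isolated (D : DecoratedPartition n m) (i : Fin n) : Prop :=
  ∃ s : ℕ, {p : ℕ | D.diagram[p]? = some i} = Set.Ico s (s + (m + 1))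

/-- The block labeled `i` is tangled: it is not isolated. -/
def Tangled (D : DecoratedPartition n m) (i : Fin n) : Prop := ¬ D.Isolated i

/-- The block labeled `i` is before the red line. -/
def BeforeRedLine (D : DecoratedPartition n m) (i : Fin n) : Prop := i ∈ D.left

/-- The `m`-sketch of `D`: a word in the letters `some (i, k)`, standing for `2^k x_i`, and `none`,
standing for the red `0`. After the red line the successive occurrences of a label `i` stand for
`x_i, 2 x_i, …, 2^m x_i` (the exponent is the number of earlier occurrences), before it they stand
for `2^m x_i, …, 2 x_i, x_i` (the exponent is the number of later occurrences). -/
def sketch (D : DecoratedPartition n m) : List (Option (Fin n × ℕ)) :=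
  (D.left.mapIdx fun p i => some (i, (D.left.drop (p + 1)).count i)) ++
    none :: (D.right.mapIdx fun p i => some (i, (D.right.take p).count i))

/-- The value at the point `x` of a letter of a sketch. -/
def letterValue (x : Fin n → ℝ) : Option (Fin n × ℕ) → ℝ
  | none => 0
  | some (i, k) => 2 ^ k * x i

/-- The region of `arrangementA n m` with which `D` is identified: the points at which the
quantities `0` and `2^k x_i` are ordered, increasingly, as in the sketch of `D`. -/
def region (D : DecoratedPartition n m) : Set (Fin n → ℝ) :=
  {x | (D.sketch.map (letterValue x)).Pairwise (· < ·)}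

/-- `D` and `D'` lie in the same region of the arrangement `H`. -/
def InSameRegion (H : Set (Set (Fin n → ℝ))) (D D' : DecoratedPartition n m) : Prop :=
  ∃ R ∈ regions H, D.region ⊆ R ∧ D'.region ⊆ R

end DecoratedPartition

/-!
A decorated partition is best read off from the occurrences of labels along its diagram: at a point
`x` of its region, the `k`-th occurrence of `i` (counted from `0`) stands for `2^k x_i` if `x_i > 0`
and for `2^(m-k) x_i` if `x_i < 0` (`occValue`). Thus `x` lies in the region if and only if the
labels with `x_i < 0` are those before the red line and these values increase along the diagram
(`mem_region_iff`).

*Regions of `arrangementA`.* A region of a central arrangement consists of all points with given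
signs of the linear forms (`connectedComponentIn_eq_cell`). The signs of the `x_i` and of the
`x_i - 2^k x_j` determine, and are determined by, the order of the values above, so the region of a
decorated partition is a whole region once it is not empty, and sorting the values at any point off
the hyperplanes recovers the partition. That an ordering of places comes from actual numbers is
equivalent to non-nesting: numbers `2^k y_i` cannot nest, and conversely a non-nesting word can be
realized by choosing the values one at a time from the right (`NonNesting.exists_increasing`).

*Regions of `arrangementB`.* The hyperplanes are those of `arrangementA` without the coordinate
hyperplanes. If two points of one region differ in the sign of the `i`-th coordinate, no `2^b x_j`
lies between two of the `2^a x_i` (`SameSideB.pow_mul_lt_iff_of_sign_ne`), that is, the block of `i`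
is isolated; hence the occurrences are ordered in the same way at both points, and the diagrams
agree. Conversely, all occurrences of an isolated block compare in the same way with those of any
other label, so the block may change sides without changing any sign of `x_i - 2^k x_j`.

*Counting.* Each region of `arrangementB` contains exactly one decorated partition whose red line
is not followed by an isolated block (`ncard_regions_arrangementB`), and those whose red line is
followed by an isolated block are given by its label and a decorated partition with the other
`n - 1` labels. It remains to count decorated partitions with `u` labels. Building words from the
right, the next letter is either new or a uniquely determined incomplete one, so that the number of
completions depends only on the numbers `h` of missing and `u` of unused letters
(`card_filter_suffix`). It equals `u! * raney u m (h + 2)`, by the recursion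
`raney (u + 1) m (r + 1) = raney (u + 1) m r + raney u m (r + 1 + m)`; the case `h = 0` is
`u! * raney u m 2`.
-/

/-! ### Non-nesting words -/

theorem isArc_cons_succ {n : ℕ} (i : Fin n) (w : List (Fin n)) (p q : ℕ) :
    IsArc (i :: w) (p + 1) (q + 1) ↔ IsArc w p q := by
  simp only [IsArc, List.getElem?_cons_succ, add_lt_add_iff_right]
  refine and_congr_right fun _ => exists_congr fun j => and_congr_right fun _ =>
    and_congr_right fun _ => ⟨fun h r h1 h2 => ?_, fun h r h1 h2 => ?_⟩
  · simpa using h (r + 1) (by omega) (by omega)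
  · obtain ⟨r, rfl⟩ : ∃ s, r = s + 1 := ⟨r - 1, by omega⟩
    simpa using h r (by omega) (by omega)

theorem isArc_cons_zero {n : ℕ} (i : Fin n) (w : List (Fin n)) (q : ℕ) :
    IsArc (i :: w) 0 (q + 1) ↔ w[q]? = some i ∧ ∀ r < q, w[r]? ≠ some i := by
  simp only [IsArc, List.getElem?_cons_succ, List.getElem?_cons_zero]
  constructor
  · rintro ⟨-, j, hj, hq, h⟩
    obtain rfl : i = j := by simpa using hj
    exact ⟨hq, fun r hr => by simpa using h (r + 1) (by omega) (by omega)⟩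
  · rintro ⟨hq, h⟩
    refine ⟨by omega, i, rfl, hq, fun r h1 h2 => ?_⟩
    obtain ⟨r, rfl⟩ : ∃ s, r = s + 1 := ⟨r - 1, by omega⟩
    simpa using h r (by omega)

theorem exists_isArc_of_getElem?_eq {n : ℕ} {w : List (Fin n)} {i : Fin n} {p q : ℕ} (hpq : p < q)
    (hp : w[p]? = some i) (hq : w[q]? = some i) : ∃ r ≤ q, IsArc w p r := by
  classical
  have hex : ∃ r, p < r ∧ w[r]? = some i := ⟨q, hpq, hq⟩
  refine ⟨Nat.find hex, Nat.find_min' hex ⟨hpq, hq⟩, (Nat.find_spec hex).1, i, hp,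
    (Nat.find_spec hex).2, fun r h1 h2 h3 => Nat.find_min hex h2 ⟨h1, h3⟩⟩

theorem takeWhile_ne_eq_take_idxOf {n : ℕ} (i : Fin n) (w : List (Fin n)) :
    w.takeWhile (· ≠ i) = w.take (w.idxOf i) := by
  induction w with
  | nil => simp
  | cons j w ih =>
    by_cases h : j = i
    · simp [h]
    · simp only [List.idxOf_cons_ne _ h, List.take_succ_cons]
      simpa [h] using ih

/-- Non-nesting can be tested letter by letter, from the right: a letter may be put in front of a
non-nesting word if no arc lies before the next occurrence of that letter. -/
theorem nonNesting_cons {n : ℕ} (i : Fin n) (w : List (Fin n)) :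
    NonNesting (i :: w) ↔ NonNesting w ∧ (i ∈ w → (w.takeWhile (· ≠ i)).Nodup) := by
  rw [takeWhile_ne_eq_take_idxOf]
  have hidx : ∀ q, (w[q]? = some i ∧ ∀ r < q, w[r]? ≠ some i) → q = w.idxOf i := by
    rintro q ⟨h1, h2⟩
    obtain ⟨hq, h1⟩ := List.getElem?_eq_some_iff.1 h1
    have hi : i ∈ w := h1 ▸ List.getElem_mem hq
    have hlt := List.idxOf_lt_length_of_mem hi
    rcases lt_trichotomy q (w.idxOf i) with h | h | h
    · exact absurd h1 (by simpa using List.not_of_lt_findIdx (p := (· == i)) (xs := w) h)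
    · exact h
    · exact absurd (by simp [hlt]) (h2 _ h)
  have hidx' : i ∈ w → (w[w.idxOf i]? = some i ∧ ∀ r < w.idxOf i, w[r]? ≠ some i) := by
    intro hi
    have hlt := List.idxOf_lt_length_of_mem hi
    refine ⟨by simp [hlt], fun r hr h => ?_⟩
    obtain ⟨hq, h1⟩ := List.getElem?_eq_some_iff.1 h
    exact absurd h1 (by simpa using List.not_of_lt_findIdx (p := (· == i)) (xs := w) hr)
  constructor
  · intro h
    refine ⟨fun p q p' q' h1 h2 h3 => h (p + 1) (q + 1) (p' + 1) (q' + 1)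
      ((isArc_cons_succ ..).2 h1) ((isArc_cons_succ ..).2 h2) (by omega), fun hi => ?_⟩
    rw [List.nodup_iff_getElem?_ne_getElem?]
    intro p q hpq hq heq
    simp only [List.length_take, lt_inf_iff] at hq
    rw [List.getElem?_take_of_lt (by omega), List.getElem?_take_of_lt (by omega)] at heq
    have hq' := List.getElem?_eq_getElem hq.2
    obtain ⟨r, hr, harc⟩ := exists_isArc_of_getElem?_eq hpq (heq.trans hq') hq'
    exact h 0 (w.idxOf i + 1) (p + 1) (r + 1) ((isArc_cons_zero ..).2 (hidx' hi))
      ((isArc_cons_succ ..).2 harc) (by omega)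
  · rintro ⟨h1, h2⟩ p q p' q' ha ha' ⟨hp, hq⟩
    have := ha'.1
    obtain ⟨p', rfl⟩ : ∃ s, p' = s + 1 := ⟨p' - 1, by omega⟩
    obtain ⟨q', rfl⟩ : ∃ s, q' = s + 1 := ⟨q' - 1, by omega⟩
    obtain ⟨q, rfl⟩ : ∃ s, q = s + 1 := ⟨q - 1, by omega⟩
    rw [isArc_cons_succ] at ha'
    rcases p with _ | p
    · rw [isArc_cons_zero] at ha
      have hi : i ∈ w := List.mem_of_getElem? ha.1
      have hnd := h2 hi
      obtain rfl := hidx q ha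
      rw [List.nodup_iff_getElem?_ne_getElem?] at hnd
      obtain ⟨hlt, j, hj, hj', -⟩ := ha'
      have hlen := List.idxOf_lt_length_of_mem hi
      refine hnd p' q' hlt (by simp; omega) ?_
      rw [List.getElem?_take_of_lt (by omega), List.getElem?_take_of_lt (by omega), hj, hj']
    · rw [isArc_cons_succ] at ha
      exact h1 p q p' q' ha ha' (by omega)

theorem nonNesting_nil {n : ℕ} : NonNesting ([] : List (Fin n)) := by
  rintro p q p' q' ⟨-, j, hj, -⟩
  simp at hj

theorem NonNesting.of_append_right {n : ℕ} {u v : List (Fin n)} (h : NonNesting (u ++ v)) :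
    NonNesting v := by
  induction u with
  | nil => exact h
  | cons i u ih => exact ih ((nonNesting_cons ..).1 h).1

theorem takeWhile_ne_append_of_mem {n : ℕ} {i : Fin n} {u : List (Fin n)} (hi : i ∈ u)
    (v : List (Fin n)) : (u ++ v).takeWhile (· ≠ i) = u.takeWhile (· ≠ i) := by
  induction u with
  | nil => simp at hi
  | cons j u ih =>
    by_cases h : j = i
    · simp [h]
    · have hi' : i ∈ u := by simpa [Ne.symm h] using hi
      simpa [h] using ih hi'

theorem nonNesting_append {n : ℕ} {u v : List (Fin n)} (hd : u.Disjoint v) :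
    NonNesting (u ++ v) ↔ NonNesting u ∧ NonNesting v := by
  induction u with
  | nil => simp [nonNesting_nil]
  | cons i u ih =>
    rw [List.disjoint_cons_left] at hd
    rw [List.cons_append, nonNesting_cons, nonNesting_cons, ih hd.2]
    by_cases hi : i ∈ u
    · rw [takeWhile_ne_append_of_mem hi]
      simp [hi]; tauto
    · simp [hi, hd.1]

theorem nonNesting_replicate {n : ℕ} (i : Fin n) (k : ℕ) : NonNesting (List.replicate k i) := by
  induction k with
  | zero => exact nonNesting_nil
  | succ k ih =>
    rw [List.replicate_succ, nonNesting_cons]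
    refine ⟨ih, fun _ => ?_⟩
    cases k <;> simp [List.replicate_succ]

/-! ### Occurrences of letters -/

/-- The word `w` with every letter `i` replaced by `(i, k)`, where `k` is the number of earlier
occurrences of `i`. -/
def occurrences {n : ℕ} : List (Fin n) → List (Fin n × ℕ)
  | [] => []
  | i :: w => (i, 0) :: (occurrences w).map fun a => (a.1, a.2 + if a.1 = i then 1 else 0)

theorem map_fst_occurrences {n : ℕ} (w : List (Fin n)) : (occurrences w).map Prod.fst = w := by
  induction w with
  | nil => rfl
  | cons i w ih => simpa [occurrences, Function.comp_def] using ih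

theorem length_occurrences {n : ℕ} (w : List (Fin n)) : (occurrences w).length = w.length := by
  conv_rhs => rw [← map_fst_occurrences w, List.length_map]

theorem mem_occurrences {n : ℕ} {w : List (Fin n)} {i : Fin n} {k : ℕ} :
    (i, k) ∈ occurrences w ↔ k < w.count i := by
  induction w generalizing k with
  | nil => simp [occurrences]
  | cons j w ih =>
    simp only [occurrences, List.mem_cons, Prod.mk.injEq, List.mem_map, Prod.exists]
    by_cases h : i = j
    · subst h
      rw [List.count_cons_self]
      constructor
      · rintro (h | ⟨a, b, h1, rfl, rfl⟩)
        · omega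
        · simpa using ih.1 h1
      · intro h
        rcases k with _ | k
        · simp
        · exact Or.inr ⟨i, k, ih.2 (by omega), rfl, by simp⟩
    · rw [List.count_cons_of_ne (Ne.symm h), ← ih]
      constructor
      · rintro (⟨h1, _⟩ | ⟨a, b, h1, rfl, rfl⟩)
        · exact absurd h1 h
        · simpa [h] using h1
      · exact fun h1 => Or.inr ⟨i, k, h1, rfl, by simp [h]⟩

theorem occurrences_append {n : ℕ} (u v : List (Fin n)) :
    occurrences (u ++ v) =
      occurrences u ++ (occurrences v).map fun a => (a.1, a.2 + u.count a.1) := by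
  induction u with
  | nil => simp [occurrences]
  | cons i u ih =>
    simp only [occurrences, List.cons_append, ih, List.map_append, List.map_map]
    congr 2
    refine List.map_congr_left fun a _ => ?_
    simp only [Function.comp, List.count_cons, beq_iff_eq, add_assoc,
      eq_comm (a := i)]

theorem occurrences_append_of_disjoint {n : ℕ} {u v : List (Fin n)} (hd : u.Disjoint v) :
    occurrences (u ++ v) = occurrences u ++ occurrences v := by
  rw [occurrences_append]
  congr 1
  conv_rhs => rw [← List.map_id (occurrences v)]
  refine List.map_congr_left fun a ha => ?_
  have hv : a.1 ∈ v := by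
    rw [← map_fst_occurrences v]; exact List.mem_map_of_mem ha
  simp [List.count_eq_zero_of_not_mem fun h => hd h hv]

theorem occurrences_eq_mapIdx {n : ℕ} (w : List (Fin n)) :
    occurrences w = w.mapIdx fun p i => (i, (w.take p).count i) := by
  induction w with
  | nil => rfl
  | cons i w ih =>
    rw [occurrences, List.mapIdx_cons, ih]
    congr 1
    refine List.ext_getElem (by simp) fun p h1 h2 => ?_
    simp [List.count_cons, eq_comm (a := i)]

/-- A list of pairs is the list of occurrences of its word of labels as soon as the pairs with a
given label `i` are `(i, 0), (i, 1), …`, in this order. -/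
theorem occurrences_map_fst {n : ℕ} (s : List (Fin n × ℕ))
    (hs : s.Pairwise fun a b => a.1 = b.1 → a.2 < b.2)
    (hc : ∀ i k k', (i, k) ∈ s → k' < k → (i, k') ∈ s) : occurrences (s.map Prod.fst) = s := by
  induction s using List.reverseRecOn with
  | nil => rfl
  | append_singleton s a ih =>
    obtain ⟨i, k⟩ := a
    rw [List.pairwise_append] at hs
    have hlast : ∀ b ∈ s, b.1 = i → b.2 < k := fun b hb => hs.2.2 b hb (i, k) (by simp)
    have ih := ih hs.1 fun j l l' h hl => by
      have := hc j l l' (by simp [h]) hl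
      rcases List.mem_append.1 this with h' | h'
      · exact h'
      · obtain ⟨rfl, rfl⟩ : j = i ∧ l' = k := by simpa using h'
        have := hlast _ h rfl
        simp only at this
        omega
    rw [List.map_append, occurrences_append, ih]
    have hcount : (s.map Prod.fst).count i = k := by
      refine le_antisymm (not_lt.1 fun h => ?_) (not_lt.1 fun h => ?_)
      · rw [← mem_occurrences, ih] at h
        exact absurd (hlast _ h rfl) (lt_irrefl _)
      · have := hc i k _ (by simp) h
        rcases List.mem_append.1 this with h' | h'
        · rw [← ih, mem_occurrences, ih] at h'
          exact absurd h' (lt_irrefl _)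
        · have : List.count i (List.map Prod.fst s) = k := by simpa using h'
          omega
    simp [occurrences, hcount]

/-! ### Realizing non-nesting words by numbers -/

/-- The places of a non-nesting word can be given increasing values of the form `2 ^ k * y i`,
where the `k`-th occurrence of the letter `i` (counted from `0`) has the value `2 ^ k * y i`.

The word is built up from the right. For the induction, every letter that could still be put in
front must get half of its first value there, which therefore has to lie below all values so
far. -/
theorem NonNesting.exists_increasing {n : ℕ} {w : List (Fin n)} (hw : NonNesting w) :
    ∃ y : Fin n → ℝ, (∀ i, 0 < y i) ∧
      (occurrences w).Pairwise (fun a b => (2 : ℝ) ^ a.2 * y a.1 < 2 ^ b.2 * y b.1) ∧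
      ∀ j ∈ w, (w.takeWhile (· ≠ j)).Nodup → ∀ a ∈ occurrences w, y j / 2 < 2 ^ a.2 * y a.1 := by
  induction w with
  | nil => exact ⟨fun _ => 1, fun _ => one_pos, List.Pairwise.nil, by simp⟩
  | cons i w ih =>
    obtain ⟨hw, hi⟩ := (nonNesting_cons ..).1 hw
    obtain ⟨y, hpos, hpw, hext⟩ := ih hw
    -- It suffices to choose the value `t` of the new place; old values are kept.
    suffices H : ∃ t : ℝ, 0 < t ∧ (i ∈ w → t = y i / 2) ∧
        (∀ a ∈ occurrences w, t < 2 ^ a.2 * y a.1) ∧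
        ∀ j ∈ w, j ≠ i → (i :: w.takeWhile (· ≠ j)).Nodup → y j / 2 < t by
      obtain ⟨t, ht, hti, hta, htj⟩ := H
      have hval : ∀ a ∈ occurrences w, (2 : ℝ) ^ (a.2 + if a.1 = i then 1 else 0) *
          Function.update y i t a.1 = 2 ^ a.2 * y a.1 := by
        intro a ha
        by_cases hai : a.1 = i
        · have hiw : i ∈ w := by
            rw [← hai, ← map_fst_occurrences w]; exact List.mem_map_of_mem ha
          simp only [hai, if_true, Function.update_self, hti hiw, pow_succ]
          ring
        · simp [hai]
      refine ⟨Function.update y i t, fun j => ?_, ?_, ?_⟩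
      · by_cases hj : j = i
        · subst hj; simpa
        · simpa [hj] using hpos j
      · rw [occurrences, List.pairwise_cons, List.pairwise_map]
        refine ⟨?_, ?_⟩
        · intro b hb
          obtain ⟨a, ha, rfl⟩ := List.mem_map.1 hb
          simp only [hval a ha, Function.update_self, pow_zero, one_mul]
          exact hta a ha
        · refine hpw.imp_of_mem fun {a b} ha hb h => ?_
          simp only [hval a ha, hval b hb]
          exact h
      · intro j hj hnd
        have key : Function.update y i t j / 2 < t := by
          by_cases hji : j = i
          · subst hji; simpa using ht
          · rw [Function.update_of_ne hji]
            refine htj j (by simpa [hji] using hj) hji ?_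
            simpa [Ne.symm hji] using hnd
        intro a ha
        rw [occurrences, List.mem_cons, List.mem_map] at ha
        rcases ha with rfl | ⟨a, ha, rfl⟩
        · simpa using key
        · simp only [hval a ha]
          exact key.trans (hta a ha)
    by_cases hiw : i ∈ w
    · refine ⟨y i / 2, by have := hpos i; positivity, fun _ => rfl, hext i hiw (hi hiw),
        fun j hj hji hnd => ?_⟩
      -- As `i` does not occur before the first `j`, the first `j` comes before the first `i`.
      have hnot : i ∉ w.takeWhile (· ≠ j) := (List.nodup_cons.1 hnd).1
      have hjn : j ∉ w.takeWhile (· ≠ j) := fun h => by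
        simpa using List.mem_takeWhile_imp h
      obtain ⟨u, v, rfl, hiu, hju⟩ : ∃ u v, w = u ++ j :: v ∧ i ∉ u ∧ j ∉ u := by
        refine ⟨w.takeWhile (· ≠ j), ?_⟩
        suffices ∃ v, w = w.takeWhile (· ≠ j) ++ j :: v from
          this.imp fun v hv => ⟨hv, hnot, hjn⟩
        clear * - hj
        induction w with
        | nil => simp at hj
        | cons k w ih =>
          by_cases hk : k = j
          · exact ⟨w, by simp [hk]⟩
          · obtain ⟨v, hv⟩ := ih (by simpa [Ne.symm hk] using hj)
            exact ⟨v, by simpa [hk] using hv⟩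
      rw [occurrences_append, List.pairwise_append] at hpw
      have hp2 := hpw.2.1
      rw [occurrences, List.map_cons, List.pairwise_cons] at hp2
      have hiv : i ∈ v := by simpa [hiu, Ne.symm hji] using hiw
      have := hp2.1 (i, 0) (by
        simp only [List.mem_map, Prod.exists, Prod.mk.injEq]
        exact ⟨i, 0, ⟨i, 0, mem_occurrences.2 (List.count_pos_iff.2 hiv), rfl,
          by simp [Ne.symm hji]⟩, rfl, by simp [List.count_eq_zero_of_not_mem hiu]⟩)
      rw [List.count_eq_zero_of_not_mem hju] at this
      simp only [pow_zero, one_mul, add_zero] at this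
      linarith
    · -- Only finitely many conditions, each lower bound being below each upper bound.
      obtain ⟨t, ht1, ht2⟩ := Order.exists_between_finsets
        (insert 0 ((w.toFinset.filter fun j => (w.takeWhile (· ≠ j)).Nodup).image fun j => y j / 2))
        ((occurrences w).toFinset.image fun a => (2 : ℝ) ^ a.2 * y a.1) (by
          simp only [Finset.mem_insert, Finset.mem_image, Finset.mem_filter, List.mem_toFinset]
          rintro a (rfl | ⟨j, ⟨hj, hnd⟩, rfl⟩) b ⟨c, hc, rfl⟩
          · have := hpos c.1
            positivity
          · exact hext j hj hnd c hc)
      simp only [Finset.mem_insert, Finset.mem_image, Finset.mem_filter, List.mem_toFinset]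
        at ht1 ht2
      exact ⟨t, ht1 0 (Or.inl rfl), fun h => absurd h hiw, fun a ha => ht2 _ ⟨a, ha, rfl⟩,
        fun j hj _ hnd => ht1 _ (Or.inr ⟨j, ⟨hj, (List.nodup_cons.1 hnd).2⟩, rfl⟩)⟩

theorem nonNesting_of_increasing {n : ℕ} {w : List (Fin n)} (y : Fin n → ℝ)
    (hpos : ∀ i, 0 < y i)
    (hy : (occurrences w).Pairwise fun a b => (2 : ℝ) ^ a.2 * y a.1 < 2 ^ b.2 * y b.1) :
    NonNesting w := by
  induction w generalizing y with
  | nil => exact nonNesting_nil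
  | cons i w ih =>
    rw [occurrences, List.pairwise_cons, List.pairwise_map] at hy
    refine (nonNesting_cons ..).2 ⟨ih (fun j => (if j = i then 2 else 1) * y j)
      (fun j => by have := hpos j; split_ifs <;> linarith) ?_, fun hi => ?_⟩
    · refine hy.2.imp fun {a b} h => ?_
      simp only at h ⊢
      convert h using 1 <;> split_ifs <;> simp [pow_succ, mul_assoc]
    · rw [List.nodup_iff_count_le_one]
      by_contra! hcon
      obtain ⟨j, hj⟩ := hcon
      have hjw : j ∈ w.takeWhile (· ≠ i) := List.count_pos_iff.1 (by omega)
      have hji : j ≠ i := by simpa using List.mem_takeWhile_imp hjw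
      have hin : i ∉ w.takeWhile (· ≠ i) := fun h => by
        simpa using List.mem_takeWhile_imp h
      have hdec := List.takeWhile_append_dropWhile (p := (· ≠ i)) (l := w)
      generalize w.takeWhile (· ≠ i) = u at *
      generalize w.dropWhile (· ≠ i) = v at *
      subst hdec
      have hiv : i ∈ v := (List.mem_append.1 hi).resolve_left hin
      have h2 := hy.2
      have h1 := hy.1 (j, 0) (List.mem_map.2 ⟨(j, 0), mem_occurrences.2
        (List.count_pos_iff.2 (List.mem_append_left _ hjw)), by simp [hji]⟩)
      rw [occurrences_append, List.pairwise_append] at h2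
      have h3 := h2.2.2 (j, 1) (mem_occurrences.2 hj) (i, 0) (List.mem_map.2
        ⟨(i, 0), mem_occurrences.2 (List.count_pos_iff.2 hiv), by
          simp [List.count_eq_zero_of_not_mem hin]⟩)
      simp [hji] at h1 h3
      linarith

/-! ### Regions as cells of sign vectors -/

/-- The region of a point off a family of linear hyperplanes consists of the points at which all
the linear forms have the same signs: this set is convex, and no connected set avoiding the
hyperplanes leaves it. -/
theorem connectedComponentIn_eq_cell {n : ℕ} (F : Set ((Fin n → ℝ) →ₗ[ℝ] ℝ)) {x : Fin n → ℝ}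
    (hx : ∀ f ∈ F, f x ≠ 0) :
    connectedComponentIn {y | ∀ f ∈ F, f y ≠ 0} x =
      {y | ∀ f ∈ F, f y ≠ 0 ∧ (f x < 0 ↔ f y < 0)} := by
  have hcell : {y | ∀ f ∈ F, f y ≠ 0 ∧ (f x < 0 ↔ f y < 0)} =
      ⋂ f ∈ F, {y | 0 < (f x • f) y} := by
    ext y
    simp only [Set.mem_ofPred_eq, Set.mem_iInter, LinearMap.smul_apply, smul_eq_mul]
    refine forall₂_congr fun f hf => ?_
    rcases lt_or_gt_of_ne (hx f hf) with h | h
    · rw [show 0 < f x * f y ↔ f y < 0 from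
        ⟨fun h' => neg_of_mul_pos_right h' h.le, mul_pos_of_neg_of_neg h⟩]
      exact ⟨fun h' => h'.2.1 h, fun h' => ⟨h'.ne, fun _ => h', fun _ => h⟩⟩
    · rw [mul_pos_iff_of_pos_left h]
      exact ⟨fun h' => lt_of_le_of_ne (not_lt.1 fun h'' => h.not_gt (h'.2.2 h'')) h'.1.symm,
        fun h' => ⟨h'.ne', fun h'' => absurd h'' h.not_gt, fun h'' => absurd h'' h'.not_gt⟩⟩
  refine Set.Subset.antisymm (fun y hy => ?_) ?_
  · rw [hcell]
    simp only [Set.mem_iInter]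
    intro f hf
    have hpre : IsPreconnected ((f x • f) '' connectedComponentIn {y | ∀ f ∈ F, f y ≠ 0} x) :=
      isPreconnected_connectedComponentIn.image _
        (LinearMap.continuous_of_finiteDimensional _).continuousOn
    have hmem := Set.mem_image_of_mem (f x • f) (mem_connectedComponentIn (x := x)
      (F := {y | ∀ f ∈ F, f y ≠ 0}) hx)
    have hymem := Set.mem_image_of_mem (f x • f) hy
    by_contra hneg
    have hneg : (f x • f) y ≤ 0 := not_lt.1 hneg
    have hpos : 0 ≤ (f x • f) x := by
      simpa using mul_self_nonneg (f x)
    obtain ⟨z, hz, hz0⟩ := hpre.Icc_subset hymem hmem ⟨hneg, hpos⟩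
    have := connectedComponentIn_subset _ _ hz f hf
    simp [hx f hf, this] at hz0
  · refine IsPreconnected.subset_connectedComponentIn ?_ (fun f hf => ⟨hx f hf, Iff.rfl⟩)
      (fun y hy f hf => (hy f hf).1)
    rw [hcell]
    refine (convex_iInter fun f => convex_iInter fun hf => ?_).isPreconnected
    exact convex_halfSpace_gt (f x • f).isLinear 0

/-- `x` lies on no hyperplane of `arrangementB n m`. -/
def OffB {n : ℕ} (m : ℕ) (x : Fin n → ℝ) : Prop :=
  ∀ i j, i ≠ j → ∀ k ≤ m, x i ≠ 2 ^ k * x j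

/-- `x` and `y` lie on the same side of every hyperplane of `arrangementB n m` (for `x` and `y` off
these hyperplanes). -/
def SameSideB {n : ℕ} (m : ℕ) (x y : Fin n → ℝ) : Prop :=
  ∀ i j, i ≠ j → ∀ k ≤ m, (x i < 2 ^ k * x j ↔ y i < 2 ^ k * y j)

/-- The region of `arrangementB n m` containing `x`. -/
def cellB {n : ℕ} (m : ℕ) (x : Fin n → ℝ) : Set (Fin n → ℝ) :=
  {y | OffB m y ∧ SameSideB m x y}

/-- The region of `arrangementA n m` containing `x`. -/
def cellA {n : ℕ} (m : ℕ) (x : Fin n → ℝ) : Set (Fin n → ℝ) :=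
  {y | OffB m y ∧ SameSideB m x y ∧ ∀ i, y i ≠ 0 ∧ (x i < 0 ↔ y i < 0)}

theorem compl_sUnion_arrangementB {n m : ℕ} :
    (⋃₀ arrangementB n m)ᶜ = {x | OffB m x} := by
  ext x
  simp only [arrangementB, Set.mem_compl_iff, Set.mem_sUnion, Set.mem_ofPred_eq, not_exists,
    not_and, OffB]
  constructor
  · intro h i j hij k hk hx
    exact h _ ⟨i, j, hij, k, hk, rfl⟩ hx
  · rintro h _ ⟨i, j, hij, k, hk, rfl⟩ hx
    exact h i j hij k hk hx

/-- The hyperplanes `x_i = 2^k x_j` with `i < j` and `-m ≤ k ≤ m` are those with `i ≠ j` and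
`0 ≤ k ≤ m`. -/
theorem compl_sUnion_arrangementA {n m : ℕ} :
    (⋃₀ arrangementA n m)ᶜ = {x | OffB m x ∧ ∀ i, x i ≠ 0} := by
  have hneg : ∀ (a b : ℝ) (k : ℕ), a = (2 : ℝ) ^ (-(k : ℤ)) * b ↔ b = 2 ^ k * a := by
    intro a b k
    rw [zpow_neg, zpow_natCast, eq_inv_mul_iff_mul_eq₀ (by positivity), eq_comm]
  ext x
  simp only [arrangementA, Set.mem_compl_iff, Set.mem_sUnion, Set.mem_union, Set.mem_ofPred_eq,
    not_exists, not_and, OffB]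
  constructor
  · refine fun h => ⟨fun i j hij k hk hx => ?_, fun i hx => h _ (Or.inl ⟨i, rfl⟩) hx⟩
    rcases lt_or_gt_of_ne hij with hlt | hlt
    · exact h _ (Or.inr ⟨i, j, hlt, k, by omega, by omega, rfl⟩) (by simpa using hx)
    · exact h _ (Or.inr ⟨j, i, hlt, -(k : ℤ), by omega, by omega, rfl⟩) ((hneg _ _ _).2 hx)
  · rintro ⟨hB, h0⟩ _ (⟨i, rfl⟩ | ⟨i, j, hij, k, hk1, hk2, rfl⟩) hx
    · exact h0 i hx
    · rcases Int.eq_nat_or_neg k with ⟨l, rfl | rfl⟩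
      · exact hB i j hij.ne l (by omega) (by simpa using hx)
      · exact hB j i hij.ne' l (by omega) ((hneg _ _ _).1 hx)

/-- The linear forms defining the hyperplanes of `arrangementB n m`. -/
def formsB (n m : ℕ) : Set ((Fin n → ℝ) →ₗ[ℝ] ℝ) :=
  {f | ∃ i j : Fin n, i ≠ j ∧ ∃ k ≤ m, f = LinearMap.proj i - (2 : ℝ) ^ k • LinearMap.proj j}

theorem forall_mem_formsB {n m : ℕ} {P : ((Fin n → ℝ) →ₗ[ℝ] ℝ) → Prop} :
    (∀ f ∈ formsB n m, P f) ↔ ∀ i j : Fin n, i ≠ j → ∀ k ≤ m,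
      P (LinearMap.proj i - (2 : ℝ) ^ k • LinearMap.proj j) :=
  ⟨fun h i j hij k hk => h _ ⟨i, j, hij, k, hk, rfl⟩,
    fun h _ ⟨i, j, hij, k, hk, e⟩ => e ▸ h i j hij k hk⟩

theorem regions_arrangementB {n m : ℕ} :
    regions (arrangementB n m) = {R | ∃ x, OffB m x ∧ R = cellB m x} := by
  have key : ∀ x : Fin n → ℝ, OffB m x → connectedComponentIn {x | OffB m x} x = cellB m x := by
    intro x hx
    have hoff : ∀ y : Fin n → ℝ, OffB m y ↔ ∀ f ∈ formsB n m, f y ≠ 0 := fun y => by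
      simp [forall_mem_formsB, sub_eq_zero, OffB]
    simp only [hoff]
    rw [connectedComponentIn_eq_cell _ ((hoff x).1 hx)]
    ext y
    simp only [cellB, SameSideB, OffB, forall_mem_formsB, Set.mem_ofPred_eq, LinearMap.sub_apply,
      LinearMap.proj_apply, LinearMap.smul_apply, smul_eq_mul, sub_neg, ne_eq, sub_eq_zero]
    exact ⟨fun h => ⟨fun i j hij k hk => (h i j hij k hk).1, fun i j hij k hk => (h i j hij k hk).2⟩,
      fun h i j hij k hk => ⟨h.1 i j hij k hk, h.2 i j hij k hk⟩⟩
  rw [regions, compl_sUnion_arrangementB]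
  ext R
  exact exists_congr fun x => and_congr_right fun hx => by rw [key x hx]

theorem regions_arrangementA {n m : ℕ} :
    regions (arrangementA n m) = {R | ∃ x, (OffB m x ∧ ∀ i, x i ≠ 0) ∧ R = cellA m x} := by
  have key : ∀ x : Fin n → ℝ, (OffB m x ∧ ∀ i, x i ≠ 0) →
      connectedComponentIn {x | OffB m x ∧ ∀ i, x i ≠ 0} x = cellA m x := by
    intro x hx
    have hoff : ∀ y : Fin n → ℝ, (OffB m y ∧ ∀ i, y i ≠ 0) ↔
        ∀ f ∈ formsB n m ∪ Set.range LinearMap.proj, f y ≠ 0 := fun y => by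
      simp [or_imp, forall_and, forall_mem_formsB, sub_eq_zero, OffB]
    simp only [hoff]
    rw [connectedComponentIn_eq_cell _ ((hoff x).1 hx)]
    ext y
    simp only [cellA, SameSideB, OffB, Set.mem_union, or_imp, forall_and, forall_mem_formsB,
      Set.mem_ofPred_eq, LinearMap.sub_apply, Set.forall_mem_range,
      LinearMap.proj_apply, LinearMap.smul_apply, smul_eq_mul, sub_neg, ne_eq, sub_eq_zero]
    tauto
  rw [regions, compl_sUnion_arrangementA]
  ext R
  exact exists_congr fun x => and_congr_right fun hx => by rw [key x hx]

theorem SameSideB.symm {n m : ℕ} {x y : Fin n → ℝ} (h : SameSideB m x y) : SameSideB m y x :=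
  fun i j hij k hk => (h i j hij k hk).symm

theorem SameSideB.trans {n m : ℕ} {x y z : Fin n → ℝ} (h : SameSideB m x y)
    (h' : SameSideB m y z) : SameSideB m x z :=
  fun i j hij k hk => (h i j hij k hk).trans (h' i j hij k hk)

theorem cellB_eq_of_sameSideB {n m : ℕ} {x y : Fin n → ℝ} (h : SameSideB m x y) :
    cellB m x = cellB m y := by
  ext z
  exact and_congr_right fun _ => ⟨h.symm.trans, h.trans⟩

theorem pow_mul_ne_of_offB {n m : ℕ} {x : Fin n → ℝ} (hx : OffB m x) {i j : Fin n} (hij : i ≠ j)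
    {a b : ℕ} (ha : a ≤ m) (hb : b ≤ m) : 2 ^ a * x i ≠ 2 ^ b * x j := by
  rcases le_total a b with hab | hab
  · obtain ⟨c, rfl⟩ := Nat.exists_eq_add_of_le hab
    rw [pow_add, mul_assoc]
    exact fun h => hx i j hij c (by omega) (mul_left_cancel₀ (by positivity) h)
  · obtain ⟨c, rfl⟩ := Nat.exists_eq_add_of_le hab
    rw [pow_add, mul_assoc]
    exact fun h => hx j i hij.symm c (by omega) (mul_left_cancel₀ (by positivity) h).symm

/-- The order of all numbers `2^a x_i` and `2^b x_j` with `a, b ≤ m` and `i ≠ j` is determined by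
the region of `arrangementB n m`. -/
theorem SameSideB.pow_mul_lt_iff {n m : ℕ} {x y : Fin n → ℝ} (hx : OffB m x) (hy : OffB m y)
    (h : SameSideB m x y) {i j : Fin n} (hij : i ≠ j) {a b : ℕ} (ha : a ≤ m) (hb : b ≤ m) :
    2 ^ a * x i < 2 ^ b * x j ↔ 2 ^ a * y i < 2 ^ b * y j := by
  rcases le_total a b with hab | hab
  · obtain ⟨c, rfl⟩ := Nat.exists_eq_add_of_le hab
    simp only [pow_add, mul_assoc]
    rw [mul_lt_mul_iff_right₀ (by positivity), mul_lt_mul_iff_right₀ (by positivity)]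
    exact h i j hij c (by omega)
  · obtain ⟨c, rfl⟩ := Nat.exists_eq_add_of_le hab
    simp only [pow_add, mul_assoc]
    rw [mul_lt_mul_iff_right₀ (by positivity), mul_lt_mul_iff_right₀ (by positivity)]
    rw [← not_le, ← not_le, le_iff_lt_or_eq, le_iff_lt_or_eq, h j i hij.symm c (by omega)]
    simp [hx j i hij.symm c (by omega), hy j i hij.symm c (by omega)]

/-- Off the hyperplanes of `arrangementB n m` one can move off the coordinate hyperplanes without
leaving the region, by a small translation along the diagonal. -/
theorem exists_sameSideB_ne_zero {n m : ℕ} {x : Fin n → ℝ} (hx : OffB m x) :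
    ∃ y, OffB m y ∧ SameSideB m x y ∧ ∀ i, y i ≠ 0 := by
  have hB : ∀ i j : Fin n, ∀ k ∈ Set.Iic m, i ≠ j → ∀ᶠ t in nhdsWithin (0 : ℝ) (Set.Ioi 0),
      x i + t ≠ 2 ^ k * (x j + t) ∧ (x i < 2 ^ k * x j ↔ x i + t < 2 ^ k * (x j + t)) := by
    intro i j k hk hij
    have hc1 : Filter.Tendsto (fun t : ℝ => x i + t) (nhdsWithin 0 (Set.Ioi 0)) (nhds (x i)) := by
      refine Filter.Tendsto.mono_left ?_ nhdsWithin_le_nhds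
      exact Continuous.tendsto' (by fun_prop) _ _ (by simp)
    have hc2 : Filter.Tendsto (fun t : ℝ => 2 ^ k * (x j + t)) (nhdsWithin 0 (Set.Ioi 0))
        (nhds (2 ^ k * x j)) := by
      refine Filter.Tendsto.mono_left ?_ nhdsWithin_le_nhds
      exact Continuous.tendsto' (by fun_prop) _ _ (by simp)
    rcases lt_or_gt_of_ne (hx i j hij k hk) with h | h
    · filter_upwards [hc1.eventually_lt hc2 h] with t ht
      exact ⟨ht.ne, iff_of_true h ht⟩
    · filter_upwards [hc2.eventually_lt hc1 h] with t ht
      exact ⟨ht.ne', iff_of_false (lt_asymm h) (lt_asymm ht)⟩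
  have h0 : ∀ i : Fin n, ∀ᶠ t in nhdsWithin (0 : ℝ) (Set.Ioi 0), x i + t ≠ 0 := by
    intro i
    by_cases hi : x i = 0
    · filter_upwards [self_mem_nhdsWithin] with t ht
      rw [hi, zero_add]
      exact (Set.mem_Ioi.1 ht).ne'
    · have hc1 : Filter.Tendsto (fun t : ℝ => x i + t) (nhdsWithin 0 (Set.Ioi 0)) (nhds (x i)) := by
        refine Filter.Tendsto.mono_left ?_ nhdsWithin_le_nhds
        exact Continuous.tendsto' (by fun_prop) _ _ (by simp)
      exact hc1.eventually_ne hi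
  have hall : ∀ᶠ t in nhdsWithin (0 : ℝ) (Set.Ioi 0), (∀ i j : Fin n, ∀ k ∈ Set.Iic m, i ≠ j →
      x i + t ≠ 2 ^ k * (x j + t) ∧ (x i < 2 ^ k * x j ↔ x i + t < 2 ^ k * (x j + t))) ∧
      ∀ i, x i + t ≠ 0 := by
    refine Filter.Eventually.and ?_ (Filter.eventually_all.2 h0)
    refine Filter.eventually_all.2 fun i => Filter.eventually_all.2 fun j =>
      (Set.finite_Iic m).eventually_all.2 fun k hk => ?_
    by_cases hij : i = j
    · exact Filter.Eventually.of_forall fun _ h => absurd hij h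
    · simpa [hij] using hB i j k hk hij
  obtain ⟨t, ht1, ht2⟩ := hall.exists
  exact ⟨fun i => x i + t, fun i j hij k hk => (ht1 i j k hk hij).1,
    fun i j hij k hk => (ht1 i j k hk hij).2, ht2⟩

/-! ### The order of the places of a diagram -/

theorem lt_iff_lt_of_pairwise {α : Type*} {f g : α → ℝ} {l : List α}
    (hf : l.Pairwise fun a b => f a < f b) (hg : l.Pairwise fun a b => g a < g b) {a b : α}
    (ha : a ∈ l) (hb : b ∈ l) : f a < f b ↔ g a < g b := by
  by_cases hab : a = b
  · simp [hab]
  let S : α → α → Prop := fun a b => (f a < f b ∧ g a < g b) ∨ (f b < f a ∧ g b < g a)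
  have : Std.Symm S := ⟨fun _ _ h => Or.symm h⟩
  have : S a b := ((hf.and hg).imp (S := S) fun h => Or.inl h).forall ha hb hab
  rcases this with h | h
  · exact iff_of_true h.1 h.2
  · exact iff_of_false h.1.not_gt h.2.not_gt

theorem eq_of_pairwise_lt {α : Type*} {f : α → ℝ} {l l' : List α}
    (h : l.Pairwise fun a b => f a < f b) (h' : l'.Pairwise fun a b => f a < f b)
    (hmem : ∀ a, a ∈ l ↔ a ∈ l') : l = l' := by
  have hn : ∀ {l : List α}, (l.Pairwise fun a b => f a < f b) → l.Nodup := fun h =>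
    h.imp fun {a b} hab e => by simp [e] at hab
  refine List.Perm.eq_of_pairwise (le := fun a b => f a < f b) ?_ h h'
    ((List.perm_ext_iff_of_nodup (hn h) (hn h')).2 hmem)
  intro a b _ _ hab hba
  exact absurd hab hba.not_gt

/-- The number for which the `k`-th occurrence of the label `i` in a diagram stands, at a point `x`
of its region: `2^k x_i` after the red line, and `2^(m-k) x_i` before it. -/
noncomputable def occValue {n : ℕ} (m : ℕ) (x : Fin n → ℝ) (a : Fin n × ℕ) : ℝ :=
  2 ^ (if x a.1 < 0 then m - a.2 else a.2) * x a.1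

theorem occValue_neg {n m : ℕ} {x : Fin n → ℝ} {a : Fin n × ℕ} (h : x a.1 < 0) :
    occValue m x a = 2 ^ (m - a.2) * x a.1 := by simp [occValue, h]

theorem occValue_pos {n m : ℕ} {x : Fin n → ℝ} {a : Fin n × ℕ} (h : 0 < x a.1) :
    occValue m x a = 2 ^ a.2 * x a.1 := by simp [occValue, h.le]

theorem occValue_lt_occValue_same {n m : ℕ} {x : Fin n → ℝ} {i : Fin n} (hi : x i ≠ 0) {p q : ℕ}
    (hp : p ≤ m) (hq : q ≤ m) : occValue m x (i, p) < occValue m x (i, q) ↔ p < q := by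
  rcases lt_or_gt_of_ne hi with h | h
  · rw [occValue_neg h, occValue_neg h, mul_lt_mul_right_of_neg h,
      pow_lt_pow_iff_right₀ (by norm_num)]
    simp only
    omega
  · rw [occValue_pos h, occValue_pos h, mul_lt_mul_iff_left₀ h,
      pow_lt_pow_iff_right₀ (by norm_num)]

theorem occValue_ne {n m : ℕ} {x : Fin n → ℝ} (hx : OffB m x) (h0 : ∀ i, x i ≠ 0)
    {a b : Fin n × ℕ} (ha : a.2 ≤ m) (hb : b.2 ≤ m) (hab : a ≠ b) :
    occValue m x a ≠ occValue m x b := by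
  obtain ⟨i, p⟩ := a
  obtain ⟨j, q⟩ := b
  by_cases hij : i = j
  · subst hij
    have hpq : p ≠ q := fun h => hab (by rw [h])
    rcases lt_or_gt_of_ne hpq with h | h
    · exact ((occValue_lt_occValue_same (h0 i) ha hb).2 h).ne
    · exact ((occValue_lt_occValue_same (h0 i) hb ha).2 h).ne'
  · refine pow_mul_ne_of_offB hx hij ?_ ?_ <;> split_ifs <;> simp only at ha hb ⊢ <;> omega

/-- If `x` and `y` are in the same region of `arrangementB n m` but have `i`-th coordinates of
different signs, then no `2^b x_j` lies between two of the numbers `x_i, 2 x_i, …, 2^m x_i`: indeed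
for `x_i < 0 < y_i` and `2^a x_i < 2^b x_j` one has `y_i ≤ 2^a y_i < 2^b y_j`, hence
`x_i < 2^b x_j`. -/
theorem SameSideB.pow_mul_lt_iff_of_sign_ne {n m : ℕ} {x y : Fin n → ℝ} (hx : OffB m x)
    (hy : OffB m y) (hx0 : ∀ i, x i ≠ 0) (hy0 : ∀ i, y i ≠ 0) (h : SameSideB m x y) {i j : Fin n}
    (hij : i ≠ j) (hs : ¬ (x i < 0 ↔ y i < 0)) {a a' b : ℕ} (ha : a ≤ m) (ha' : a' ≤ m)
    (hb : b ≤ m) : 2 ^ a * x i < 2 ^ b * x j ↔ 2 ^ a' * x i < 2 ^ b * x j := by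
  suffices H : ∀ a ≤ m, (2 ^ a * x i < 2 ^ b * x j ↔ x i < 2 ^ b * x j) by
    rw [H a ha, H a' ha']
  intro a ha
  have e1 := h.pow_mul_lt_iff hx hy hij ha hb
  have e0 := h.pow_mul_lt_iff hx hy hij (Nat.zero_le m) hb
  rw [pow_zero, one_mul, one_mul] at e0
  have h2 : (1 : ℝ) ≤ 2 ^ a := one_le_pow₀ (by norm_num)
  rcases lt_or_gt_of_ne (hx0 i) with hxi | hxi
  · have hyi : 0 < y i := lt_of_le_of_ne (not_lt.1 fun h' => hs (by simp [hxi, h'])) (hy0 i).symm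
    refine ⟨fun h' => e0.2 (lt_of_le_of_lt ?_ (e1.1 h')), fun h' => lt_of_le_of_lt ?_ h'⟩
    · nlinarith
    · nlinarith
  · have hyi : y i < 0 := by
      by_contra h'
      exact hs (by simp [hxi.le, h'])
    refine ⟨fun h' => lt_of_le_of_lt ?_ h', fun h' => e1.2 (lt_of_le_of_lt ?_ (e0.1 h'))⟩
    · nlinarith
    · nlinarith

/-- Points in the same region of `arrangementB n m` order the occurrences of labels in the same
way, even if they differ in the signs of some coordinates. -/
theorem SameSideB.occValue_lt_iff {n m : ℕ} {x y : Fin n → ℝ} (hx : OffB m x)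
    (hy : OffB m y) (hx0 : ∀ i, x i ≠ 0) (hy0 : ∀ i, y i ≠ 0) (h : SameSideB m x y)
    {a b : Fin n × ℕ} (ha : a.2 ≤ m) (hb : b.2 ≤ m) :
    occValue m x a < occValue m x b ↔ occValue m y a < occValue m y b := by
  obtain ⟨i, p⟩ := a
  obtain ⟨j, q⟩ := b
  by_cases hij : i = j
  · subst hij
    rw [occValue_lt_occValue_same (hx0 i) ha hb, occValue_lt_occValue_same (hy0 i) ha hb]
  have he : ∀ (z : Fin n → ℝ) (i : Fin n) (p : ℕ), p ≤ m → (if z i < 0 then m - p else p) ≤ m := by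
    intro z i p hp
    split_ifs <;> omega
  simp only [occValue]
  have hxi := he x i p ha
  have hyi := he y i p ha
  have hxj := he x j q hb
  have hyj := he y j q hb
  rw [← h.pow_mul_lt_iff hx hy hij hyi hyj]
  trans 2 ^ (if y i < 0 then m - p else p) * x i < 2 ^ (if x j < 0 then m - q else q) * x j
  · by_cases hs : x i < 0 ↔ y i < 0
    · simp only [hs]
    · exact h.pow_mul_lt_iff_of_sign_ne hx hy hx0 hy0 hij hs hxi hyi hxj
  · by_cases hs : x j < 0 ↔ y j < 0
    · simp only [hs]
    · have hji : j ≠ i := Ne.symm hij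
      have e := h.pow_mul_lt_iff_of_sign_ne hx hy hx0 hy0 hji hs hxj hyj hyi
      have e1 := pow_mul_ne_of_offB hx hji hxj hyi
      have e2 := pow_mul_ne_of_offB hx hji hyj hyi
      exact ⟨fun h' => lt_of_le_of_ne (not_lt.1 fun h'' => h'.not_gt (e.2 h'')) e2.symm,
        fun h' => lt_of_le_of_ne (not_lt.1 fun h'' => h'.not_gt (e.1 h'')) e1.symm⟩

/-! ### The regions of decorated partitions -/

namespace DecoratedPartition

variable {n m : ℕ}

theorem ext {D D' : DecoratedPartition n m} (hl : D.left = D'.left) (hr : D.right = D'.right) :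
    D = D' := by
  cases D; cases D'; simp only at hl hr; subst hl hr; rfl

theorem count_diagram (D : DecoratedPartition n m) (i : Fin n) : D.diagram.count i = m + 1 := by
  rw [diagram, List.count_append]
  have := D.blocks i
  omega

theorem mem_left_iff (D : DecoratedPartition n m) {i : Fin n} :
    i ∈ D.left ↔ D.left.count i = m + 1 ∧ D.right.count i = 0 := by
  rw [← List.count_pos_iff]
  have := D.blocks i
  omega

theorem mem_right_iff (D : DecoratedPartition n m) {i : Fin n} :
    i ∈ D.right ↔ D.left.count i = 0 ∧ D.right.count i = m + 1 := by
  rw [← List.count_pos_iff]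
  have := D.blocks i
  omega

theorem not_mem_left_iff (D : DecoratedPartition n m) {i : Fin n} : i ∉ D.left ↔ i ∈ D.right := by
  rw [mem_left_iff, mem_right_iff]
  have := D.blocks i
  omega

theorem disjoint (D : DecoratedPartition n m) : D.left.Disjoint D.right := fun _ hl hr =>
  D.not_mem_left_iff.2 hr hl

theorem mem_occurrences_diagram (D : DecoratedPartition n m) {a : Fin n × ℕ} :
    a ∈ occurrences D.diagram ↔ a.2 ≤ m := by
  obtain ⟨i, k⟩ := a
  rw [mem_occurrences, count_diagram, Nat.lt_succ_iff]

theorem sketch_eq (D : DecoratedPartition n m) :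
    D.sketch = ((occurrences D.left).map fun a => some (a.1, m - a.2)) ++
      none :: (occurrences D.right).map some := by
  rw [sketch, occurrences_eq_mapIdx, occurrences_eq_mapIdx]
  congr 1
  · refine List.ext_getElem (by simp) fun p h1 h2 => ?_
    simp only [List.length_mapIdx] at h1
    simp only [List.getElem_mapIdx, List.getElem_map, Option.some.injEq, Prod.mk.injEq, true_and]
    have hm := (D.mem_left_iff.1 (List.getElem_mem h1)).1
    have hc : D.left.count D.left[p] = (D.left.take p ++ D.left[p] :: D.left.drop (p + 1)).count
        D.left[p] := by
      rw [List.cons_getElem_drop_succ, List.take_append_drop]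
    rw [hm, List.count_append, List.count_cons_self] at hc
    omega
  · congr 1
    exact List.ext_getElem (by simp) fun p h1 h2 => by simp

theorem mem_region_iff (D : DecoratedPartition n m) {x : Fin n → ℝ} :
    x ∈ D.region ↔ (∀ i ∈ D.left, x i < 0) ∧ (∀ i ∈ D.right, 0 < x i) ∧
      (occurrences D.diagram).Pairwise fun a b => occValue m x a < occValue m x b := by
  have hl : ∀ {a}, a ∈ occurrences D.left → a.1 ∈ D.left := fun {a} ha =>
    map_fst_occurrences D.left ▸ List.mem_map_of_mem (f := Prod.fst) ha
  have hr : ∀ {a}, a ∈ occurrences D.right → a.1 ∈ D.right := fun {a} ha =>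
    map_fst_occurrences D.right ▸ List.mem_map_of_mem (f := Prod.fst) ha
  have hl0 : ∀ {i}, i ∈ D.left → (i, 0) ∈ occurrences D.left := fun hi =>
    mem_occurrences.2 (List.count_pos_iff.2 hi)
  have hr0 : ∀ {i}, i ∈ D.right → (i, 0) ∈ occurrences D.right := fun hi =>
    mem_occurrences.2 (List.count_pos_iff.2 hi)
  have hpow : ∀ k : ℕ, (0 : ℝ) < 2 ^ k := fun k => by positivity
  rw [region, Set.mem_ofPred_eq, sketch_eq, List.map_append, List.map_cons, List.map_map,
    List.map_map, List.pairwise_append, List.pairwise_cons, List.pairwise_map, List.pairwise_map,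
    diagram, occurrences_append_of_disjoint D.disjoint, List.pairwise_append]
  simp only [List.mem_map, List.mem_cons, Function.comp, letterValue, forall_exists_index, and_imp,
    forall_apply_eq_imp_iff₂, forall_eq_or_imp]
  constructor
  · rintro ⟨h1, ⟨h2, h3⟩, h4⟩
    have hneg : ∀ i ∈ D.left, x i < 0 := fun i hi =>
      (pos_iff_neg_of_mul_neg ((h4 _ (hl0 hi)).1)).1 (hpow _)
    have hpos : ∀ i ∈ D.right, 0 < x i := fun i hi =>
      (pos_iff_pos_of_mul_pos (h2 _ (hr0 hi))).1 (hpow _)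
    refine ⟨hneg, hpos, h1.imp_of_mem fun {a b} ha hb h => ?_,
      h3.imp_of_mem fun {a b} ha hb h => ?_, fun a ha b hb => ?_⟩
    · rwa [occValue_neg (hneg _ (hl ha)), occValue_neg (hneg _ (hl hb))]
    · rwa [occValue_pos (hpos _ (hr ha)), occValue_pos (hpos _ (hr hb))]
    · rw [occValue_neg (hneg _ (hl ha)), occValue_pos (hpos _ (hr hb))]
      exact (h4 a ha).2 b hb
  · rintro ⟨hneg, hpos, h1, h3, h4⟩
    refine ⟨h1.imp_of_mem fun {a b} ha hb h => ?_,
      ⟨fun a ha => mul_pos (hpow _) (hpos _ (hr ha)),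
        h3.imp_of_mem fun {a b} ha hb h => ?_⟩,
      fun a ha => ⟨mul_neg_of_pos_of_neg (hpow _) (hneg _ (hl ha)), fun b hb => ?_⟩⟩
    · rwa [occValue_neg (hneg _ (hl ha)), occValue_neg (hneg _ (hl hb))] at h
    · rwa [occValue_pos (hpos _ (hr ha)), occValue_pos (hpos _ (hr hb))] at h
    · have := h4 a ha b hb
      rwa [occValue_neg (hneg _ (hl ha)), occValue_pos (hpos _ (hr hb))] at this

theorem neg_iff_of_mem_region {D : DecoratedPartition n m} {x : Fin n → ℝ} (hx : x ∈ D.region)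
    (i : Fin n) : x i < 0 ↔ i ∈ D.left := by
  obtain ⟨h1, h2, -⟩ := D.mem_region_iff.1 hx
  refine ⟨fun h => ?_, h1 i⟩
  by_contra hi
  exact (h2 i (D.not_mem_left_iff.1 hi)).not_gt h

theorem ne_zero_of_mem_region {D : DecoratedPartition n m} {x : Fin n → ℝ} (hx : x ∈ D.region)
    (i : Fin n) : x i ≠ 0 := by
  obtain ⟨h1, h2, -⟩ := D.mem_region_iff.1 hx
  by_cases hi : i ∈ D.left
  · exact (h1 i hi).ne
  · exact (h2 i (D.not_mem_left_iff.1 hi)).ne'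

theorem offB_of_mem_region {D : DecoratedPartition n m} {x : Fin n → ℝ} (hx : x ∈ D.region) :
    OffB m x := by
  intro i j hij k hk he
  have hpw := (D.mem_region_iff.1 hx).2.2
  have hne : ∀ a b : Fin n × ℕ, a.2 ≤ m → b.2 ≤ m → a ≠ b → occValue m x a ≠ occValue m x b :=
    fun a b ha hb hab => by
      let S : Fin n × ℕ → Fin n × ℕ → Prop := fun a b => occValue m x a ≠ occValue m x b
      have : Std.Symm S := ⟨fun _ _ h => Ne.symm h⟩
      exact (hpw.imp (S := S) fun h => h.ne).forall (D.mem_occurrences_diagram.2 ha)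
        (D.mem_occurrences_diagram.2 hb) hab
  rcases lt_or_gt_of_ne (ne_zero_of_mem_region hx i) with hi | hi
  · have hj : x j < 0 := by
      rw [he] at hi
      exact (pos_iff_neg_of_mul_neg hi).1 (by positivity)
    refine hne (i, m) (j, m - k) le_rfl (Nat.sub_le _ _) (by simp [hij]) ?_
    rw [occValue_neg hi, occValue_neg hj]
    simpa [Nat.sub_sub_self hk] using he
  · have hj : 0 < x j := by
      rw [he] at hi
      exact (pos_iff_pos_of_mul_pos hi).1 (by positivity)
    refine hne (i, 0) (j, k) (Nat.zero_le _) hk (by simp [hij]) ?_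
    rw [occValue_pos hi, occValue_pos hj]
    simpa using he

/-- The region of a decorated partition is a whole region of `arrangementA n m`. -/
theorem region_eq_cellA {D : DecoratedPartition n m} {x : Fin n → ℝ} (hx : x ∈ D.region) :
    D.region = cellA m x := by
  have hpx := (D.mem_region_iff.1 hx).2.2
  ext y
  constructor
  · intro hy
    have hpy := (D.mem_region_iff.1 hy).2.2
    have hsign : ∀ i, x i < 0 ↔ y i < 0 := fun i => by
      rw [neg_iff_of_mem_region hx, neg_iff_of_mem_region hy]
    refine ⟨offB_of_mem_region hy, fun i j hij k hk => ?_,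
      fun i => ⟨ne_zero_of_mem_region hy i, hsign i⟩⟩
    have hcmp : ∀ a b : Fin n × ℕ, a.2 ≤ m → b.2 ≤ m →
        (occValue m x a < occValue m x b ↔ occValue m y a < occValue m y b) := fun a b ha hb =>
      lt_iff_lt_of_pairwise hpx hpy (D.mem_occurrences_diagram.2 ha)
        (D.mem_occurrences_diagram.2 hb)
    have hpow : ∀ k : ℕ, (0 : ℝ) < 2 ^ k := fun k => by positivity
    have hpos : ∀ i, 0 < x i → 0 < y i := fun i hi =>
      lt_of_le_of_ne (not_lt.1 fun h => hi.not_gt ((hsign i).2 h)) (ne_zero_of_mem_region hy i).symm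
    rcases lt_or_gt_of_ne (ne_zero_of_mem_region hx i) with hi | hi <;>
      rcases lt_or_gt_of_ne (ne_zero_of_mem_region hx j) with hj | hj
    · have := hcmp (i, m) (j, m - k) le_rfl (Nat.sub_le _ _)
      rw [occValue_neg hi, occValue_neg hj, occValue_neg ((hsign i).1 hi),
        occValue_neg ((hsign j).1 hj)] at this
      simpa [Nat.sub_sub_self hk] using this
    · have h1 := mul_pos (hpow k) hj
      have h2 := mul_pos (hpow k) (hpos j hj)
      have h3 := (hsign i).1 hi
      exact iff_of_true (hi.trans h1) (h3.trans h2)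
    · have h1 := mul_neg_of_pos_of_neg (hpow k) hj
      have h2 := mul_neg_of_pos_of_neg (hpow k) ((hsign j).1 hj)
      exact iff_of_false (h1.trans hi).not_gt (h2.trans (hpos i hi)).not_gt
    · have := hcmp (i, 0) (j, k) (Nat.zero_le _) hk
      rw [occValue_pos hi, occValue_pos hj, occValue_pos (hpos i hi),
        occValue_pos (hpos j hj)] at this
      simpa using this
  · rintro ⟨hy, hs, hy0⟩
    have h0 := ne_zero_of_mem_region hx
    refine D.mem_region_iff.2 ⟨fun i hi => ?_, fun i hi => ?_, hpx.imp_of_mem fun {a b} ha hb h => ?_⟩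
    · rw [← (hy0 i).2, neg_iff_of_mem_region hx]
      exact hi
    · refine lt_of_le_of_ne (not_lt.1 fun h => ?_) (hy0 i).1.symm
      rw [← (hy0 i).2, neg_iff_of_mem_region hx] at h
      exact D.not_mem_left_iff.2 hi h
    · exact (hs.occValue_lt_iff (offB_of_mem_region hx) hy h0 (fun i => (hy0 i).1)
        (D.mem_occurrences_diagram.1 ha) (D.mem_occurrences_diagram.1 hb)).1 h

theorem region_nonempty (D : DecoratedPartition n m) : D.region.Nonempty := by
  obtain ⟨y, hy, hpy, -⟩ := D.nonNesting_left.exists_increasing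
  obtain ⟨z, hz, hpz, -⟩ := D.nonNesting_right.exists_increasing
  -- Before the red line the values are the negatives of the inverses of `2 ^ k * y i`.
  let x : Fin n → ℝ := fun i => if i ∈ D.left then -(2 ^ m * y i)⁻¹ else z i
  have hpow : ∀ k : ℕ, (0 : ℝ) < 2 ^ k := fun k => by positivity
  have hneg : ∀ i ∈ D.left, x i < 0 := fun i hi => by
    have := mul_pos (hpow m) (hy i)
    simp only [x, hi, if_true]
    simpa using this
  have hpos : ∀ i ∈ D.right, 0 < x i := fun i hi => by
    simpa [x, D.not_mem_left_iff.2 hi] using hz i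
  have hl : ∀ a ∈ occurrences D.left,
      a.1 ∈ D.left ∧ occValue m x a = -(2 ^ a.2 * y a.1)⁻¹ := by
    rintro ⟨i, k⟩ ha
    rw [mem_occurrences] at ha
    have hi : i ∈ D.left := List.count_pos_iff.1 (by omega)
    rw [(D.mem_left_iff.1 hi).1] at ha
    refine ⟨hi, ?_⟩
    rw [occValue_neg (hneg i hi)]
    have hy' := (hy i).ne'
    obtain ⟨c, rfl⟩ := Nat.exists_eq_add_of_le (Nat.lt_succ_iff.1 ha)
    simp only [x, hi, if_true, Nat.add_sub_cancel_left, pow_add]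
    field_simp
  have hr : ∀ a ∈ occurrences D.right,
      a.1 ∈ D.right ∧ occValue m x a = 2 ^ a.2 * z a.1 := by
    rintro ⟨i, k⟩ ha
    rw [mem_occurrences] at ha
    have hi : i ∈ D.right := List.count_pos_iff.1 (by omega)
    refine ⟨hi, ?_⟩
    rw [occValue_pos (hpos i hi)]
    simp [x, D.not_mem_left_iff.2 hi]
  refine ⟨x, D.mem_region_iff.2 ⟨hneg, hpos, ?_⟩⟩
  rw [diagram, occurrences_append_of_disjoint D.disjoint, List.pairwise_append]
  refine ⟨hpy.imp_of_mem fun {a b} ha hb h => ?_, hpz.imp_of_mem fun {a b} ha hb h => ?_,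
    fun a ha b hb => ?_⟩
  · rw [(hl a ha).2, (hl b hb).2]
    have := mul_pos (hpow a.2) (hy a.1)
    exact neg_lt_neg (inv_strictAnti₀ this h)
  · rwa [(hr a ha).2, (hr b hb).2]
  · rw [(hl a ha).2, (hr b hb).2]
    have h1 := mul_pos (hpow a.2) (hy a.1)
    have h2 := mul_pos (hpow b.2) (hz b.1)
    exact (neg_lt_zero.2 (inv_pos.2 h1)).trans h2

theorem left_eq_filter {D : DecoratedPartition n m} {x : Fin n → ℝ} (hx : x ∈ D.region) :
    D.left = D.diagram.filter (fun i => x i < 0) := by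
  have h1 := fun i => neg_iff_of_mem_region hx i
  rw [diagram, List.filter_append, List.filter_eq_self.2 (by simp [h1]),
    List.filter_eq_nil_iff.2 (fun i hi => by simpa using fun h => D.disjoint ((h1 i).1 h) hi),
    List.append_nil]

theorem right_eq_filter {D : DecoratedPartition n m} {x : Fin n → ℝ} (hx : x ∈ D.region) :
    D.right = D.diagram.filter (fun i => ¬ x i < 0) := by
  have h1 := fun i => neg_iff_of_mem_region hx i
  rw [diagram, List.filter_append, List.filter_eq_nil_iff.2 (by simp [h1]),
    List.filter_eq_self.2 (fun i hi => by simpa using fun h => D.disjoint ((h1 i).1 h) hi),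
    List.nil_append]

theorem region_injective : Function.Injective (region (n := n) (m := m)) := by
  intro D D' h
  obtain ⟨x, hx⟩ := D.region_nonempty
  have hx' : x ∈ D'.region := h ▸ hx
  have hocc : occurrences D.diagram = occurrences D'.diagram :=
    eq_of_pairwise_lt (D.mem_region_iff.1 hx).2.2 (D'.mem_region_iff.1 hx').2.2 fun a => by
      rw [mem_occurrences_diagram, mem_occurrences_diagram]
  have hd : D.diagram = D'.diagram := by
    rw [← map_fst_occurrences D.diagram, hocc, map_fst_occurrences]
  exact ext (by rw [left_eq_filter hx, left_eq_filter hx', hd])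
    (by rw [right_eq_filter hx, right_eq_filter hx', hd])

/-- Every point off the hyperplanes of `arrangementA n m` lies in the region of a decorated
partition: sort the numbers `2^k x_i` and record their labels. -/
theorem exists_mem_region {x : Fin n → ℝ} (hx : OffB m x) (h0 : ∀ i, x i ≠ 0) :
    ∃ D : DecoratedPartition n m, x ∈ D.region := by
  classical
  have hpow : ∀ k : ℕ, (0 : ℝ) < 2 ^ k := fun k => by positivity
  let r : Fin n × ℕ → Fin n × ℕ → Prop := fun a b => occValue m x a ≤ occValue m x b
  have : Std.Total r := ⟨fun a b => le_total _ _⟩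
  have : IsTrans _ r := ⟨fun a b c => le_trans⟩
  obtain ⟨s, hs, hmem⟩ : ∃ s : List (Fin n × ℕ),
      (s.Pairwise fun a b => occValue m x a < occValue m x b) ∧ ∀ a, a ∈ s ↔ a.2 ≤ m := by
    let l := ((Finset.univ : Finset (Fin n)) ×ˢ Finset.range (m + 1)).toList
    have hl : ∀ a, a ∈ l.insertionSort r ↔ a.2 ≤ m := fun a => by
      simp [l]
    refine ⟨l.insertionSort r, ?_, hl⟩
    have hnd : (l.insertionSort r).Nodup :=
      (List.perm_insertionSort r l).nodup_iff.2 (Finset.nodup_toList _)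
    refine ((List.pairwise_insertionSort r l).and hnd).imp_of_mem fun {a b} ha hb h => ?_
    exact lt_of_le_of_ne h.1 (occValue_ne hx h0 ((hl a).1 ha) ((hl b).1 hb) h.2)
  have hsame : s.Pairwise fun a b => a.1 = b.1 → a.2 < b.2 :=
    hs.imp_of_mem fun {a b} ha hb h hab => by
      obtain ⟨i, p⟩ := a
      obtain ⟨j, q⟩ := b
      obtain rfl : i = j := hab
      exact (occValue_lt_occValue_same (h0 i) ((hmem _).1 ha) ((hmem _).1 hb)).1 h
  have hocc : ∀ P : Fin n → Bool, occurrences ((s.filter fun a => P a.1).map Prod.fst) =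
      s.filter fun a => P a.1 := fun P => by
    refine occurrences_map_fst _ (hsame.filter _) fun i k k' h hk => ?_
    rw [List.mem_filter, hmem] at h ⊢
    exact ⟨hk.le.trans h.1, h.2⟩
  have hcount : ∀ (P : Fin n → Bool) (i : Fin n),
      ((s.filter fun a => P a.1).map Prod.fst).count i = if P i then m + 1 else 0 := by
    intro P i
    refine eq_of_forall_lt_iff fun k => ?_
    rw [← mem_occurrences, hocc, List.mem_filter, hmem]
    split_ifs with h <;> simp [h]
  have hposi : ∀ i, ¬ x i < 0 → 0 < x i := fun i hi => lt_of_le_of_ne (not_lt.1 hi) (h0 i).symm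
  refine ⟨⟨(s.filter fun a => decide (x a.1 < 0)).map Prod.fst,
    (s.filter fun a => !decide (x a.1 < 0)).map Prod.fst, ?_, ?_, fun i => ?_⟩, ?_⟩
  · -- On the negative side, `-1 / (2 ^ k * y i) = 2 ^ (m - k) * x i`.
    refine nonNesting_of_increasing (fun i => if x i < 0 then (2 ^ m * -x i)⁻¹ else 1)
      (fun i => ?_) ?_
    · split_ifs with hi
      · have := mul_pos (hpow m) (neg_pos.2 hi)
        positivity
      · exact one_pos
    · rw [hocc fun i => decide (x i < 0)]
      refine (hs.filter _).imp_of_mem fun {a b} ha hb h => ?_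
      simp only [List.mem_filter, hmem, decide_eq_true_eq] at ha hb
      rw [occValue_neg ha.2, occValue_neg hb.2] at h
      have key : ∀ c : Fin n × ℕ, c.2 ≤ m ∧ x c.1 < 0 →
          (2 : ℝ) ^ c.2 * (2 ^ m * -x c.1)⁻¹ = (-(2 ^ (m - c.2) * x c.1))⁻¹ := by
        rintro ⟨i, k⟩ ⟨hk, hi⟩
        obtain ⟨c, rfl⟩ := Nat.exists_eq_add_of_le hk
        have := hi.ne
        simp only [Nat.add_sub_cancel_left, pow_add] at this ⊢
        field_simp
      simp only [ha.2, hb.2, if_true]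
      rw [key a ha, key b hb]
      exact inv_strictAnti₀ (neg_pos.2 (mul_neg_of_pos_of_neg (hpow _) hb.2)) (neg_lt_neg h)
  · refine nonNesting_of_increasing (fun i => |x i|) (fun i => abs_pos.2 (h0 i)) ?_
    rw [hocc fun i => !decide (x i < 0)]
    refine (hs.filter _).imp_of_mem fun {a b} ha hb h => ?_
    simp only [List.mem_filter, hmem, Bool.not_eq_true', decide_eq_false_iff_not] at ha hb
    have ha' := hposi _ ha.2
    have hb' := hposi _ hb.2
    rwa [occValue_pos ha', occValue_pos hb', ← abs_of_pos ha', ← abs_of_pos hb'] at h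
  · rw [hcount fun i => decide (x i < 0), hcount fun i => !decide (x i < 0)]
    by_cases hi : x i < 0 <;> simp [hi]
  · rw [mem_region_iff]
    have hneg' : ∀ i ∈ (s.filter fun a => decide (x a.1 < 0)).map Prod.fst, x i < 0 := by
      intro i hi
      obtain ⟨a, ha, rfl⟩ := List.mem_map.1 hi
      simpa using (List.mem_filter.1 ha).2
    have hpos' : ∀ i ∈ (s.filter fun a => !decide (x a.1 < 0)).map Prod.fst, 0 < x i := by
      intro i hi
      obtain ⟨a, ha, rfl⟩ := List.mem_map.1 hi
      exact hposi _ (by simpa using (List.mem_filter.1 ha).2)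
    refine ⟨hneg', hpos', ?_⟩
    rw [diagram, occurrences_append_of_disjoint fun i hl hr => (hneg' i hl).not_gt (hpos' i hr),
      hocc fun i => decide (x i < 0), hocc fun i => !decide (x i < 0), List.pairwise_append]
    refine ⟨hs.filter _, hs.filter _, fun a ha b hb => ?_⟩
    have ha' := hneg' a.1 (List.mem_map_of_mem ha)
    have hb' := hpos' b.1 (List.mem_map_of_mem hb)
    rw [occValue_neg ha', occValue_pos hb']
    exact (mul_neg_of_pos_of_neg (hpow _) ha').trans (mul_pos (hpow _) hb')

theorem bijOn_region : Set.BijOn (region (n := n) (m := m)) Set.univ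
    (regions (arrangementA n m)) := by
  refine ⟨fun D _ => ?_, region_injective.injOn, fun R hR => ?_⟩
  · obtain ⟨x, hx⟩ := D.region_nonempty
    rw [regions_arrangementA]
    exact ⟨x, ⟨offB_of_mem_region hx, ne_zero_of_mem_region hx⟩, region_eq_cellA hx⟩
  · rw [regions_arrangementA] at hR
    obtain ⟨x, ⟨hx, h0⟩, rfl⟩ := hR
    obtain ⟨D, hD⟩ := exists_mem_region hx h0
    exact ⟨D, trivial, region_eq_cellA hD⟩

end DecoratedPartition

/-! ### Decorated partitions in the same region of `arrangementB n m` -/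

theorem card_filter_getElem?_eq {n : ℕ} (w : List (Fin n)) (i : Fin n) :
    ((Finset.range w.length).filter fun p => w[p]? = some i).card = w.count i := by
  induction w using List.reverseRecOn with
  | nil => simp
  | append_singleton w j ih =>
    rw [List.length_append, List.length_singleton, Finset.range_add_one, Finset.filter_insert,
      List.count_append, ← ih]
    have hfil : ((Finset.range w.length).filter fun p => (w ++ [j])[p]? = some i) =
        (Finset.range w.length).filter fun p => w[p]? = some i := by
      refine Finset.filter_congr fun p hp => ?_
      rw [List.getElem?_append_left (Finset.mem_range.1 hp)]
    by_cases hj : j = i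
    · subst hj
      simp [hfil]
    · simp [hfil, hj]

theorem exists_eq_Ico_of_card {S : Finset ℕ} {k : ℕ} (hcard : S.card = k + 1)
    (hconv : ∀ p ∈ S, ∀ q ∈ S, ∀ r, p < r → r < q → r ∈ S) :
    ∃ s, (S : Set ℕ) = Set.Ico s (s + (k + 1)) := by
  have hne : S.Nonempty := Finset.card_pos.1 (by omega)
  have hS : S = Finset.Icc (S.min' hne) (S.max' hne) := by
    ext r
    rw [Finset.mem_Icc]
    refine ⟨fun h => ⟨S.min'_le r h, S.le_max' r h⟩, fun ⟨h1, h2⟩ => ?_⟩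
    rcases h1.eq_or_lt with h1 | h1
    · exact h1 ▸ S.min'_mem hne
    rcases h2.eq_or_lt with h2 | h2
    · exact h2 ▸ S.max'_mem hne
    exact hconv _ (S.min'_mem hne) _ (S.max'_mem hne) r h1 h2
  refine ⟨S.min' hne, ?_⟩
  have hc := congrArg Finset.card hS
  rw [Nat.card_Icc, hcard] at hc
  conv_lhs => rw [hS]
  ext r
  simp only [Finset.coe_Icc, Set.mem_Icc, Set.mem_Ico]
  omega

namespace DecoratedPartition

variable {n m : ℕ}

theorem getElem?_diagram_of_getElem_occurrences {D : DecoratedPartition n m} {r : ℕ}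
    (hr : r < (occurrences D.diagram).length) :
    D.diagram[r]? = some (occurrences D.diagram)[r].1 := by
  have h : ((occurrences D.diagram).map Prod.fst)[r]? = some (occurrences D.diagram)[r].1 := by
    simp [hr]
  rwa [map_fst_occurrences] at h

theorem occValue_getElem_lt_iff {D : DecoratedPartition n m} {x : Fin n → ℝ} (hx : x ∈ D.region)
    {r t : ℕ} (hr : r < (occurrences D.diagram).length) (ht : t < (occurrences D.diagram).length) :
    occValue m x (occurrences D.diagram)[r] < occValue m x (occurrences D.diagram)[t] ↔ r < t := by
  have hpw := List.pairwise_iff_getElem.1 (D.mem_region_iff.1 hx).2.2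
  refine ⟨fun h => ?_, hpw r t hr ht⟩
  by_contra hrt
  rcases (not_lt.1 hrt).eq_or_lt with e | hlt
  · subst e; exact lt_irrefl _ h
  · exact (hpw t r ht hr hlt).not_gt h

/-- A block is isolated exactly if no number belonging to another label lies between two of the
numbers belonging to its own label. -/
theorem isolated_iff {D : DecoratedPartition n m} {x : Fin n → ℝ} (hx : x ∈ D.region) (i : Fin n) :
    D.Isolated i ↔ ∀ j, j ≠ i → ∀ p ≤ m, ∀ p' ≤ m, ∀ q ≤ m,
      occValue m x (i, p) < occValue m x (j, q) → occValue m x (i, p') < occValue m x (j, q) := by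
  constructor
  · rintro ⟨s, hs⟩ j hj p hp p' hp' q hq
    obtain ⟨a, ha, hap⟩ := List.getElem_of_mem (D.mem_occurrences_diagram (a := (i, p)).2 hp)
    obtain ⟨b, hb, hbp⟩ := List.getElem_of_mem (D.mem_occurrences_diagram (a := (i, p')).2 hp')
    obtain ⟨c, hc, hcp⟩ := List.getElem_of_mem (D.mem_occurrences_diagram (a := (j, q)).2 hq)
    have ha' : a ∈ {p : ℕ | D.diagram[p]? = some i} := by
      rw [Set.mem_ofPred_eq, getElem?_diagram_of_getElem_occurrences ha, hap]
    have hb' : b ∈ {p : ℕ | D.diagram[p]? = some i} := by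
      rw [Set.mem_ofPred_eq, getElem?_diagram_of_getElem_occurrences hb, hbp]
    have hc' : c ∉ {p : ℕ | D.diagram[p]? = some i} := by
      rw [Set.mem_ofPred_eq, getElem?_diagram_of_getElem_occurrences hc, hcp]
      simpa using hj
    rw [hs, Set.mem_Ico] at ha' hb' hc'
    rw [← hap, ← hbp, ← hcp, occValue_getElem_lt_iff hx, occValue_getElem_lt_iff hx]
    omega
  · intro h
    have hset : {p : ℕ | D.diagram[p]? = some i} =
        (((Finset.range D.diagram.length).filter fun p => D.diagram[p]? = some i : Finset ℕ) :
          Set ℕ) := by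
      ext p
      simp only [Set.mem_ofPred_eq, Finset.coe_filter, Finset.mem_range]
      exact ⟨fun h => ⟨(List.getElem?_eq_some_iff.1 h).1, h⟩, fun h => h.2⟩
    rw [Isolated, hset]
    refine exists_eq_Ico_of_card (by rw [card_filter_getElem?_eq, count_diagram]) ?_
    simp only [Finset.mem_filter, Finset.mem_range]
    rintro a ⟨ha, hai⟩ b ⟨hb, hbi⟩ c hac hcb
    refine ⟨by omega, ?_⟩
    rw [← length_occurrences] at ha hb
    have hc : c < (occurrences D.diagram).length := by omega
    rw [getElem?_diagram_of_getElem_occurrences ha, Option.some.injEq] at hai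
    rw [getElem?_diagram_of_getElem_occurrences hb, Option.some.injEq] at hbi
    rw [getElem?_diagram_of_getElem_occurrences hc, Option.some.injEq]
    by_contra hci
    have hm : ∀ {r} (hr : r < (occurrences D.diagram).length), (occurrences D.diagram)[r].2 ≤ m :=
      fun hr => D.mem_occurrences_diagram.1 (List.getElem_mem hr)
    have h1 := (occValue_getElem_lt_iff hx ha hc).2 hac
    have h2 := (occValue_getElem_lt_iff hx hc hb).2 hcb
    have h3 := h _ hci _ (hm ha) _ (hm hb) _ (hm hc) (by
      rw [← hai]
      exact h1)
    rw [← hbi] at h3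
    exact h3.not_gt h2

theorem inSameRegion_iff_sameSideB {D D' : DecoratedPartition n m} {x y : Fin n → ℝ}
    (hx : x ∈ D.region) (hy : y ∈ D'.region) :
    InSameRegion (arrangementB n m) D D' ↔ SameSideB m x y := by
  have hsub : ∀ z : Fin n → ℝ, cellA m z ⊆ cellB m z := fun z w h => ⟨h.1, h.2.1⟩
  rw [InSameRegion, regions_arrangementB]
  constructor
  · rintro ⟨_, ⟨z, -, rfl⟩, h, h'⟩
    exact (h hx).2.symm.trans (h' hy).2
  · intro h
    refine ⟨cellB m x, ⟨x, offB_of_mem_region hx, rfl⟩, ?_, ?_⟩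
    · rw [region_eq_cellA hx]
      exact hsub x
    · rw [region_eq_cellA hy, cellB_eq_of_sameSideB h]
      exact hsub y

theorem InSameRegion.diagram_eq {D D' : DecoratedPartition n m}
    (h : InSameRegion (arrangementB n m) D D') : D.diagram = D'.diagram := by
  obtain ⟨x, hx⟩ := D.region_nonempty
  obtain ⟨y, hy⟩ := D'.region_nonempty
  have hs := (inSameRegion_iff_sameSideB hx hy).1 h
  have hocc : occurrences D.diagram = occurrences D'.diagram := by
    refine eq_of_pairwise_lt (f := occValue m x) (D.mem_region_iff.1 hx).2.2
      ((D'.mem_region_iff.1 hy).2.2.imp_of_mem fun {a b} ha hb h => ?_) fun a => by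
        rw [mem_occurrences_diagram, mem_occurrences_diagram]
    exact (hs.occValue_lt_iff (offB_of_mem_region hx) (offB_of_mem_region hy)
      (ne_zero_of_mem_region hx) (ne_zero_of_mem_region hy) (D'.mem_occurrences_diagram.1 ha)
      (D'.mem_occurrences_diagram.1 hb)).2 h
  rw [← map_fst_occurrences D.diagram, hocc, map_fst_occurrences]

theorem InSameRegion.isolated_of_not_iff {D D' : DecoratedPartition n m}
    (h : InSameRegion (arrangementB n m) D D') {i : Fin n}
    (hi : ¬ (D.BeforeRedLine i ↔ D'.BeforeRedLine i)) : D.Isolated i := by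
  obtain ⟨x, hx⟩ := D.region_nonempty
  obtain ⟨y, hy⟩ := D'.region_nonempty
  have hs := (inSameRegion_iff_sameSideB hx hy).1 h
  rw [BeforeRedLine, BeforeRedLine, ← neg_iff_of_mem_region hx, ← neg_iff_of_mem_region hy] at hi
  rw [isolated_iff hx]
  intro j hj p hp p' hp' q hq
  refine (hs.pow_mul_lt_iff_of_sign_ne (offB_of_mem_region hx) (offB_of_mem_region hy)
    (ne_zero_of_mem_region hx) (ne_zero_of_mem_region hy) hj.symm hi ?_ ?_ ?_).1 <;>
  · simp only
    split_ifs <;> omega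

theorem inSameRegion_of_diagram_eq {D D' : DecoratedPartition n m} (hd : D.diagram = D'.diagram)
    (ht : ∀ i, D.Tangled i → (D.BeforeRedLine i ↔ D'.BeforeRedLine i)) :
    InSameRegion (arrangementB n m) D D' := by
  obtain ⟨x, hx⟩ := D.region_nonempty
  obtain ⟨y, hy⟩ := D'.region_nonempty
  rw [inSameRegion_iff_sameSideB hx hy]
  have hpx := (D.mem_region_iff.1 hx).2.2
  have hpy := (D'.mem_region_iff.1 hy).2.2
  rw [← hd] at hpy
  have hiso : ∀ i, ¬ (x i < 0 ↔ y i < 0) → D.Isolated i := fun i hi => by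
    rw [neg_iff_of_mem_region hx, neg_iff_of_mem_region hy] at hi
    by_contra hcon
    exact hi (ht i hcon)
  intro i j hij k hk
  have hval : ∀ z : Fin n → ℝ, z i < 2 ^ k * z j ↔
      occValue m z (i, if z i < 0 then m else 0) <
        occValue m z (j, if z j < 0 then m - k else k) := fun z => by
    simp only [occValue]
    split_ifs <;> simp [Nat.sub_sub_self hk]
  have hle : ∀ z : ℝ, (if z < 0 then m else 0) ≤ m := fun z => by split_ifs <;> omega
  have hle' : ∀ z : ℝ, (if z < 0 then m - k else k) ≤ m := fun z => by split_ifs <;> omega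
  rw [hval x, hval y, ← lt_iff_lt_of_pairwise hpx hpy (D.mem_occurrences_diagram.2 (hle _))
    (D.mem_occurrences_diagram.2 (hle' _))]
  -- If `i` changes sides, its block is isolated, and all its occurrences compare in the same way
  -- with those of `j`; likewise for `j`.
  trans occValue m x (i, if y i < 0 then m else 0) <
    occValue m x (j, if x j < 0 then m - k else k)
  · by_cases hs : x i < 0 ↔ y i < 0
    · simp only [hs]
    · have := (isolated_iff hx i).1 (hiso i hs) j hij.symm
      exact ⟨this _ (hle _) _ (hle _) _ (hle' _), this _ (hle _) _ (hle _) _ (hle' _)⟩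
  · by_cases hs : x j < 0 ↔ y j < 0
    · simp only [hs]
    · have := (isolated_iff hx j).1 (hiso j hs) i hij
      have hne : ∀ p q, p ≤ m → q ≤ m → occValue m x (i, p) ≠ occValue m x (j, q) := fun p q hp hq =>
        occValue_ne (offB_of_mem_region hx) (ne_zero_of_mem_region hx) hp hq (by simp [hij])
      exact ⟨fun h' => lt_of_le_of_ne (not_lt.1 fun h'' => h'.not_gt
          (this _ (hle' _) _ (hle' _) _ (hle _) h'')) (hne _ _ (hle _) (hle' _)),
        fun h' => lt_of_le_of_ne (not_lt.1 fun h'' => h'.not_gt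
          (this _ (hle' _) _ (hle' _) _ (hle _) h'')) (hne _ _ (hle _) (hle' _))⟩

theorem inSameRegion_iff (D D' : DecoratedPartition n m) :
    InSameRegion (arrangementB n m) D D' ↔ D.diagram = D'.diagram ∧
      ∀ i : Fin n, D.Tangled i → (D.BeforeRedLine i ↔ D'.BeforeRedLine i) :=
  ⟨fun h => ⟨h.diagram_eq, fun _ hi => by_contra fun hcon => hi (h.isolated_of_not_iff hcon)⟩,
    fun h => inSameRegion_of_diagram_eq h.1 h.2⟩

/-! ### Representatives with the red line as far to the right as possible -/

/-- The diagram after the red line does not begin with an isolated block, so that the red line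
cannot be moved to the right within the same region of `arrangementB n m`. -/
def RedLineLast (D : DecoratedPartition n m) : Prop :=
  ∀ i : Fin n, ¬ List.replicate (m + 1) i <+: D.right

theorem isolated_of_prefix {D : DecoratedPartition n m} {i : Fin n}
    (h : List.replicate (m + 1) i <+: D.right) : D.Isolated i := by
  obtain ⟨v, hv⟩ := h
  have hi : i ∈ D.right := by
    rw [← hv]
    simp
  have hl : i ∉ D.left := D.not_mem_left_iff.2 hi
  have hc := (D.mem_right_iff.1 hi).2
  rw [← hv, List.count_append, List.count_replicate_self] at hc
  have hiv : i ∉ v := fun h => by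
    have := List.count_pos_iff.2 h
    omega
  refine ⟨D.left.length, ?_⟩
  ext p
  rw [Set.mem_ofPred_eq, Set.mem_Ico, diagram, ← hv]
  rcases lt_or_ge p D.left.length with h | h
  · rw [List.getElem?_append_left h]
    exact iff_of_false (fun h' => hl (List.mem_of_getElem? h')) (by omega)
  · rw [List.getElem?_append_right h]
    rcases lt_or_ge (p - D.left.length) (m + 1) with h' | h'
    · rw [List.getElem?_append_left (by simpa using h')]
      exact iff_of_true (by simp [h']) (by omega)
    · rw [List.getElem?_append_right (by simpa using h')]
      exact iff_of_false (fun h' => hiv (List.mem_of_getElem? h')) (by omega)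

theorem InSameRegion.trans {H : Set (Set (Fin n → ℝ))} {D₁ D₂ D₃ : DecoratedPartition n m}
    (h : InSameRegion H D₁ D₂) (h' : InSameRegion H D₂ D₃) : InSameRegion H D₁ D₃ := by
  obtain ⟨_, ⟨x, hx, rfl⟩, h1, h2⟩ := h
  obtain ⟨_, ⟨y, hy, rfl⟩, h3, h4⟩ := h'
  obtain ⟨z, hz⟩ := D₂.region_nonempty
  refine ⟨_, ⟨x, hx, rfl⟩, h1, ?_⟩
  rw [connectedComponentIn_eq (h2 hz), ← connectedComponentIn_eq (h3 hz)]
  exact h4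

theorem exists_redLineLast (D : DecoratedPartition n m) :
    ∃ D', D'.RedLineLast ∧ InSameRegion (arrangementB n m) D D' := by
  induction hk : D.right.length using Nat.strong_induction_on generalizing D with
  | _ k ih =>
    by_cases hD : D.RedLineLast
    · exact ⟨D, hD, (inSameRegion_iff D D).2 ⟨rfl, fun _ _ => Iff.rfl⟩⟩
    simp only [RedLineLast, not_forall, not_not] at hD
    obtain ⟨i, hi⟩ := hD
    have hiso := isolated_of_prefix hi
    obtain ⟨v, hv⟩ := hi
    have hir : i ∈ D.right := by
      rw [← hv]
      simp
    have hil : i ∉ D.left := D.not_mem_left_iff.2 hir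
    have hci := (D.mem_right_iff.1 hir).2
    rw [← hv, List.count_append, List.count_replicate_self] at hci
    have hb : ∀ j, ((D.left ++ List.replicate (m + 1) i).count j = m + 1 ∧ v.count j = 0) ∨
        ((D.left ++ List.replicate (m + 1) i).count j = 0 ∧ v.count j = m + 1) := by
      intro j
      have := D.blocks j
      rw [← hv] at this
      simp only [List.count_append, List.count_replicate, beq_iff_eq] at this ⊢
      by_cases hij : i = j
      · subst hij
        simp [List.count_eq_zero_of_not_mem hil]
        omega
      · simpa [hij] using this
    let D₁ : DecoratedPartition n m :=
      { left := D.left ++ List.replicate (m + 1) i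
        right := v
        nonNesting_left := (nonNesting_append fun j h1 h2 =>
          hil (by rwa [List.eq_of_mem_replicate h2] at h1)).2 ⟨D.nonNesting_left, nonNesting_replicate i _⟩
        nonNesting_right := NonNesting.of_append_right (hv.symm ▸ D.nonNesting_right)
        blocks := hb }
    have h1 : InSameRegion (arrangementB n m) D D₁ := by
      refine (inSameRegion_iff D D₁).2 ⟨?_, fun j hj => ?_⟩
      · rw [diagram, diagram, ← hv, List.append_assoc]
      · have hji : j ≠ i := fun e => hj (e ▸ hiso)
        simp [BeforeRedLine, D₁, hji]
    obtain ⟨D', hD', h2⟩ := ih v.length (by rw [← hk, ← hv]; simp) D₁ rfl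
    exact ⟨D', hD', h1.trans h2⟩

theorem RedLineLast.eq_of_length_le {D D' : DecoratedPartition n m} (hD : D.RedLineLast)
    (hd : D.diagram = D'.diagram)
    (ht : ∀ i, D.Tangled i → (D.BeforeRedLine i ↔ D'.BeforeRedLine i))
    (hlen : D.left.length ≤ D'.left.length) : D = D' := by
  have hpre : D.left <+: D'.left := by
    refine List.prefix_of_prefix_length_le (l₃ := D.diagram) (List.prefix_append _ _) ?_ hlen
    rw [hd]
    exact List.prefix_append _ _
  obtain ⟨s, hs⟩ := hpre
  have hr : D.right = s ++ D'.right := by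
    rw [diagram, diagram, ← hs, List.append_assoc] at hd
    exact List.append_cancel_left hd
  rcases s with _ | ⟨i, s⟩
  · exact ext (by simpa using hs) (by simpa using hr)
  exfalso
  have hir : i ∈ D.right := by simp [hr]
  have hil : i ∉ D.left := D.not_mem_left_iff.2 hir
  have hil' : i ∈ D'.left := by simp [← hs]
  have hiso : D.Isolated i := by
    by_contra hcon
    exact hil ((ht i hcon).2 hil')
  obtain ⟨t, ht⟩ := hiso
  -- The first place after the red line carries `i`, and no place before it does.
  have h1 : D.left.length ∈ Set.Ico t (t + (m + 1)) := by
    rw [← ht, Set.mem_ofPred_eq, diagram, List.getElem?_append_right le_rfl, hr]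
    simp
  have h2 : t = D.left.length := by
    refine le_antisymm h1.1 (not_lt.1 fun h => ?_)
    have : t ∈ Set.Ico t (t + (m + 1)) := by simp
    rw [← ht, Set.mem_ofPred_eq, diagram, List.getElem?_append_left h] at this
    exact hil (List.mem_of_getElem? this)
  refine hD i (List.prefix_iff_getElem?.2 fun p hp => ?_)
  rw [List.length_replicate] at hp
  have : D.left.length + p ∈ Set.Ico t (t + (m + 1)) := by
    rw [Set.mem_Ico]; omega
  rw [← ht, Set.mem_ofPred_eq, diagram, List.getElem?_append_right (by omega)] at this
  simpa using this

theorem RedLineLast.eq_of_inSameRegion {D D' : DecoratedPartition n m} (hD : D.RedLineLast)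
    (hD' : D'.RedLineLast) (h : InSameRegion (arrangementB n m) D D') : D = D' := by
  obtain ⟨hd, ht⟩ := (inSameRegion_iff D D').1 h
  rcases le_total D.left.length D'.left.length with hlen | hlen
  · exact hD.eq_of_length_le hd ht hlen
  · refine (hD'.eq_of_length_le hd.symm (fun i hi => (ht i ?_).symm) hlen).symm
    rwa [Tangled, Isolated, hd]

/-- Every region of `arrangementB n m` contains the region of exactly one decorated partition whose
red line is as far to the right as possible. -/
theorem ncard_regions_arrangementB :
    (regions (arrangementB n m)).ncard = {D : DecoratedPartition n m | D.RedLineLast}.ncard := by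
  have hmem : ∀ D : DecoratedPartition n m, ∃ R ∈ regions (arrangementB n m), D.region ⊆ R := by
    intro D
    obtain ⟨R, hR, h, -⟩ := (inSameRegion_iff D D).2 ⟨rfl, fun _ _ => Iff.rfl⟩
    exact ⟨R, hR, h⟩
  choose f hf hsub using hmem
  symm
  refine Set.ncard_congr (fun D _ => f D) (fun D _ => hf D) (fun D D' hD hD' h => ?_)
    (fun R hR => ?_)
  · exact RedLineLast.eq_of_inSameRegion hD hD' ⟨f D, hf D, hsub D, h ▸ hsub D'⟩
  · obtain ⟨x, hx, hRx⟩ := (regions_arrangementB ▸ hR : R ∈ {R | ∃ x, OffB m x ∧ R = cellB m x})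
    obtain ⟨y, hy, hxy, hy0⟩ := exists_sameSideB_ne_zero hx
    obtain ⟨D, hD⟩ := exists_mem_region hy hy0
    obtain ⟨D', hD', h⟩ := exists_redLineLast D
    refine ⟨D', hD', ?_⟩
    obtain ⟨z, hz⟩ := D'.region_nonempty
    have hyz := (inSameRegion_iff_sameSideB hD hz).1 h
    obtain ⟨u, hu, hfu⟩ :=
      (regions_arrangementB ▸ hf D' : f D' ∈ {R | ∃ x, OffB m x ∧ R = cellB m x})
    have hzu : z ∈ cellB m u := hfu ▸ hsub D' hz
    rw [hfu, hRx, cellB_eq_of_sameSideB (hxy.trans hyz), cellB_eq_of_sameSideB hzu.2]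

end DecoratedPartition

/-! ### Counting by completing words to the left -/

/-- `w` is a non-nesting word over `S` in which every letter occurs at most `m + 1` times, and each
letter that occurs less often can still be put in front without creating a nesting. These turn out
to be the words that can be completed to the left (see `card_filter_suffix`). -/
structure Extendable {n : ℕ} (m : ℕ) (S : Finset (Fin n)) (w : List (Fin n)) : Prop where
  nonNesting : NonNesting w
  mem : ∀ i ∈ w, i ∈ S
  count_le : ∀ i, w.count i ≤ m + 1
  nodup : ∀ i ∈ w, w.count i < m + 1 → (w.takeWhile (· ≠ i)).Nodup

/-- `w` is a non-nesting word over `S` in which every letter that occurs does so `m + 1` times. -/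
structure Complete {n : ℕ} (m : ℕ) (S : Finset (Fin n)) (w : List (Fin n)) : Prop where
  nonNesting : NonNesting w
  mem : ∀ i ∈ w, i ∈ S
  count_eq : ∀ i ∈ w, w.count i = m + 1

/-- The number of further occurrences that the letters of `w` need to occur `m + 1` times each. -/
def missing {n : ℕ} (m : ℕ) (w : List (Fin n)) : ℕ := ∑ i ∈ w.toFinset, (m + 1 - w.count i)

/-- The number of letters of `S` that do not occur in `w`. -/
def unused {n : ℕ} (S : Finset (Fin n)) (w : List (Fin n)) : ℕ := (S \ w.toFinset).card

section

variable {n m : ℕ} {S : Finset (Fin n)} {w : List (Fin n)} {i : Fin n}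

theorem Complete.extendable (h : Complete m S w) : Extendable m S w where
  nonNesting := h.nonNesting
  mem := h.mem
  count_le i := by
    by_cases hi : i ∈ w
    · exact (h.count_eq i hi).le
    · simp [List.count_eq_zero_of_not_mem hi]
  nodup i hi hlt := absurd (h.count_eq i hi) hlt.ne

theorem Extendable.complete (h : Extendable m S w) (h0 : missing m w = 0) : Complete m S w where
  nonNesting := h.nonNesting
  mem := h.mem
  count_eq i hi := by
    rw [missing, Finset.sum_eq_zero_iff] at h0
    have := h0 i (by simpa using hi)
    have := h.count_le i
    omega

theorem Complete.missing_eq_zero (h : Complete m S w) : missing m w = 0 := by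
  rw [missing, Finset.sum_eq_zero_iff]
  intro i hi
  rw [h.count_eq i (by simpa using hi), Nat.sub_self]

theorem extendable_nil : Extendable m S [] := ⟨nonNesting_nil, by simp, by simp, by simp⟩

theorem Extendable.of_cons (h : Extendable m S (i :: w)) : Extendable m S w where
  nonNesting := ((nonNesting_cons ..).1 h.nonNesting).1
  mem j hj := h.mem j (by simp [hj])
  count_le j := (List.count_le_count_cons ..).trans (h.count_le j)
  nodup j hj hlt := by
    by_cases hji : j = i
    · subst hji
      exact ((nonNesting_cons ..).1 h.nonNesting).2 hj
    · have := h.nodup j (by simp [hj]) (by rwa [List.count_cons_of_ne (Ne.symm hji)])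
      rw [List.takeWhile_cons_of_pos (by simpa using Ne.symm hji)] at this
      exact (List.nodup_cons.1 this).2

theorem Extendable.of_suffix {v : List (Fin n)} (h : Extendable m S v) (hw : w <:+ v) :
    Extendable m S w := by
  obtain ⟨u, rfl⟩ := hw
  induction u with
  | nil => exact h
  | cons i u ih => exact ih h.of_cons

theorem extendable_cons_of_not_mem (h : Extendable m S w) (hi : i ∉ w) (hS : i ∈ S) :
    Extendable m S (i :: w) where
  nonNesting := (nonNesting_cons ..).2 ⟨h.nonNesting, fun h => absurd h hi⟩
  mem j hj := by
    rcases List.mem_cons.1 hj with rfl | hj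
    · exact hS
    · exact h.mem j hj
  count_le j := by
    by_cases hji : j = i
    · subst hji
      simp [List.count_eq_zero_of_not_mem hi]
    · rw [List.count_cons_of_ne (Ne.symm hji)]
      exact h.count_le j
  nodup j hj hlt := by
    by_cases hji : j = i
    · simp [hji]
    · rw [List.count_cons_of_ne (Ne.symm hji)] at hlt
      rw [List.takeWhile_cons_of_pos (by simpa using Ne.symm hji), List.nodup_cons]
      exact ⟨fun hmem => hi ((List.takeWhile_prefix _).subset hmem),
        h.nodup j (by simpa [hji] using hj) hlt⟩

/-- If some letters of `w` are incomplete, exactly one letter of `w` can be put in front such that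
the word stays extendable: the incomplete letter whose first occurrence comes last. -/
theorem Extendable.exists_forall_cons_iff (h : Extendable m S w) (h0 : missing m w ≠ 0) :
    ∃ i ∈ w, w.count i < m + 1 ∧ ∀ j ∈ w, Extendable m S (j :: w) ↔ j = i := by
  have hne : (w.toFinset.filter fun i => w.count i < m + 1).Nonempty := by
    by_contra hcon
    rw [Finset.not_nonempty_iff_eq_empty, Finset.filter_eq_empty_iff] at hcon
    refine h0 (Finset.sum_eq_zero fun i hi => ?_)
    have := hcon hi
    omega
  obtain ⟨i, hi, hmax⟩ := Finset.exists_max_image _ (fun i => w.idxOf i) hne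
  simp only [Finset.mem_filter, List.mem_toFinset] at hi hmax
  refine ⟨i, hi.1, hi.2, fun j hj => ⟨fun hext => ?_, ?_⟩⟩
  · by_contra hji
    have hcj := hext.count_le j
    rw [List.count_cons_self] at hcj
    have hle := hmax j ⟨hj, by omega⟩
    have hnd := hext.nodup i (by simp [hi.1])
      (by rw [List.count_cons_of_ne hji]; exact hi.2)
    rw [List.takeWhile_cons_of_pos (by simpa using hji), List.nodup_cons,
      takeWhile_ne_eq_take_idxOf, List.mem_take_iff_idxOf_lt hj] at hnd
    exact hji ((List.idxOf_inj hj).1 (le_antisymm hle (not_lt.1 hnd.1)))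
  · rintro rfl
    refine ⟨(nonNesting_cons ..).2 ⟨h.nonNesting, fun _ => h.nodup j hj hi.2⟩, fun k hk => ?_,
      fun k => ?_, fun k hk hlt => ?_⟩
    · rcases List.mem_cons.1 hk with rfl | hk
      · exact h.mem _ hj
      · exact h.mem k hk
    · by_cases hkj : k = j
      · subst hkj
        rw [List.count_cons_self]
        exact hi.2
      · rw [List.count_cons_of_ne (Ne.symm hkj)]
        exact h.count_le k
    · by_cases hkj : k = j
      · simp [hkj]
      · rw [List.count_cons_of_ne (Ne.symm hkj)] at hlt
        have hkw : k ∈ w := by simpa [hkj] using hk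
        rw [List.takeWhile_cons_of_pos (by simpa using Ne.symm hkj), List.nodup_cons]
        refine ⟨?_, h.nodup k hkw hlt⟩
        rw [takeWhile_ne_eq_take_idxOf, List.mem_take_iff_idxOf_lt hj, not_lt]
        exact hmax k ⟨hkw, hlt⟩

theorem missing_cons_of_not_mem (hi : i ∉ w) : missing m (i :: w) = missing m w + m := by
  rw [missing, List.toFinset_cons, Finset.sum_insert (by simpa using hi), List.count_cons_self,
    List.count_eq_zero_of_not_mem hi, missing, add_comm]
  congr 1
  refine Finset.sum_congr rfl fun j hj => ?_
  rw [List.count_cons_of_ne]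
  rintro rfl
  exact hi (by simpa using hj)

theorem missing_cons_of_mem (hi : i ∈ w) (hlt : w.count i < m + 1) :
    missing m (i :: w) + 1 = missing m w := by
  have hi' : i ∈ w.toFinset := by simpa using hi
  rw [missing, missing, List.toFinset_cons, Finset.insert_eq_self.2 hi',
    ← Finset.add_sum_erase _ _ hi', ← Finset.add_sum_erase _ _ hi', List.count_cons_self]
  have : ∀ j ∈ w.toFinset.erase i, m + 1 - (i :: w).count j = m + 1 - w.count j := fun j hj => by
    rw [List.count_cons_of_ne (Finset.ne_of_mem_erase hj).symm]
  rw [Finset.sum_congr rfl this]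
  omega

theorem unused_cons_of_not_mem (hi : i ∉ w) (hS : i ∈ S) : unused S (i :: w) + 1 = unused S w := by
  rw [unused, unused, List.toFinset_cons, Finset.sdiff_insert, Finset.card_erase_add_one]
  simp [hi, hS]

theorem unused_cons_of_mem (hi : i ∈ w) : unused S (i :: w) = unused S w := by
  rw [unused, unused, List.toFinset_cons, Finset.insert_eq_self.2 (by simpa using hi)]

theorem ite_suffix_eq (w l : List (Fin n)) :
    (if w <:+ l then 1 else 0 : ℚ) =
      (if l = w then 1 else 0) + ∑ i, if i :: w <:+ l then 1 else 0 := by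
  by_cases hl : l = w
  · subst hl
    rw [Finset.sum_eq_zero fun i _ => if_neg fun h => by simpa using h.length_le]
    simp
  · rw [if_neg hl, zero_add]
    by_cases h : w <:+ l
    · obtain ⟨u, hu⟩ := h
      rcases List.eq_nil_or_concat' u with rfl | ⟨v, j, rfl⟩
      · exact absurd (by simpa using hu.symm) hl
      · have hj : ∀ i, i :: w <:+ l ↔ i = j := by
          rintro i
          constructor
          · rintro ⟨u', hu'⟩
            rw [← hu, List.append_assoc] at hu'
            simpa using List.cons.inj (List.append_inj_right' hu' (by simp)) |>.1
          · rintro rfl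
            exact ⟨v, by simpa using hu⟩
        rw [if_pos ⟨_, hu⟩]
        simp [hj]
    · rw [if_neg h, Finset.sum_eq_zero]
      intro i _
      exact if_neg fun h' => h ((List.suffix_cons i w).trans h')

/-- The number of objects `x` whose complete word `f x` ends with a given extendable word `w`
depends only on the numbers `h` of missing and `u` of unused letters of `w`: the next letter to the
left of `w` is either one of the `u` unused ones, or (for `h ≠ 0`) the only incomplete one that is
possible. The recursion for the function `G` says the same; `c u` is the number of objects whose
word is a given complete word with `u` unused letters. -/
theorem card_filter_suffix {α : Type*} (X : Finset α) (f : α → List (Fin n))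
    (hf : ∀ x ∈ X, Complete m S (f x)) (c : ℕ → ℚ) (G : ℕ → ℕ → ℚ)
    (hG0 : ∀ u, G 0 u = c u + u * G m (u - 1))
    (hG : ∀ h u, G (h + 1) u = G h u + u * G (h + 1 + m) (u - 1))
    (hc : ∀ w, Complete m S w → ((X.filter fun x => f x = w).card : ℚ) = c (unused S w))
    (hw : Extendable m S w) :
    ((X.filter fun x => w <:+ f x).card : ℚ) = G (missing m w) (unused S w) := by
  induction hN : unused S w * (m + 1) + missing m w using Nat.strong_induction_on generalizing w with
  | _ N ih =>
    have hsum : ((X.filter fun x => w <:+ f x).card : ℚ) =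
        (X.filter fun x => f x = w).card + ∑ i, ((X.filter fun x => i :: w <:+ f x).card : ℚ) := by
      simp only [Finset.card_filter, Nat.cast_sum, Nat.cast_ite, Nat.cast_one, Nat.cast_zero]
      rw [Finset.sum_comm, ← Finset.sum_add_distrib]
      exact Finset.sum_congr rfl fun x _ => ite_suffix_eq w (f x)
    have hzero : ∀ i, ¬ Extendable m S (i :: w) →
        ((X.filter fun x => i :: w <:+ f x).card : ℚ) = 0 := by
      intro i hi
      rw [Nat.cast_eq_zero, Finset.card_eq_zero, Finset.filter_eq_empty_iff]
      exact fun x hx h => hi ((hf x hx).extendable.of_suffix h)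
    have hnew : ∀ i ∉ w, ((X.filter fun x => i :: w <:+ f x).card : ℚ) =
        if i ∈ S \ w.toFinset then G (missing m w + m) (unused S w - 1) else 0 := by
      intro i hi
      by_cases hS : i ∈ S
      · have hu := unused_cons_of_not_mem hi hS
        have hmis := missing_cons_of_not_mem (m := m) hi
        rw [if_pos (by simp [hS, hi]), ih _ _ (extendable_cons_of_not_mem hw hi hS) rfl, hmis, ← hu,
          Nat.add_sub_cancel]
        rw [hmis, ← hN, ← hu, add_mul]
        omega
      · rw [if_neg (by simp [hS]), hzero i fun h => hS (h.mem i (by simp))]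
    have hconst : ∑ i, (if i ∈ S \ w.toFinset then G (missing m w + m) (unused S w - 1) else 0) =
        unused S w * G (missing m w + m) (unused S w - 1) := by
      rw [Finset.sum_ite_mem, Finset.univ_inter, Finset.sum_const, nsmul_eq_mul, unused]
    rw [hsum]
    by_cases h0 : missing m w = 0
    · have hcw := hw.complete h0
      have hall : ∀ i, ((X.filter fun x => i :: w <:+ f x).card : ℚ) =
          if i ∈ S \ w.toFinset then G (missing m w + m) (unused S w - 1) else 0 := by
        intro i
        by_cases hi : i ∈ w
        · rw [if_neg (by simp [hi]), hzero i fun h => ?_]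
          have := h.count_le i
          rw [List.count_cons_self, hcw.count_eq i hi] at this
          omega
        · exact hnew i hi
      rw [Finset.sum_congr rfl fun i _ => hall i, hconst, hc w hcw, h0, zero_add, hG0]
    · obtain ⟨j, hj, hlt, hiff⟩ := hw.exists_forall_cons_iff h0
      obtain ⟨h, hh⟩ := Nat.exists_eq_succ_of_ne_zero h0
      have hmis := missing_cons_of_mem hj hlt
      have hall : ∀ i, ((X.filter fun x => i :: w <:+ f x).card : ℚ) =
          (if i ∈ S \ w.toFinset then G (missing m w + m) (unused S w - 1) else 0) +
            if i = j then G h (unused S w) else 0 := by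
        intro i
        by_cases hi : i ∈ w
        · rw [if_neg (by simp [hi]), zero_add]
          by_cases hij : i = j
          · subst hij
            rw [if_pos rfl, ih _ _ ((hiff i hi).2 rfl) rfl, unused_cons_of_mem hi]
            · congr 1
              omega
            · rw [unused_cons_of_mem hi]
              omega
          · rw [if_neg hij, hzero i fun h => hij ((hiff i hi).1 h)]
        · have hij : i ≠ j := fun e => hi (e ▸ hj)
          rw [hnew i hi, if_neg hij, add_zero]
      have hempty : ((X.filter fun x => f x = w).card : ℚ) = 0 := by
        rw [Nat.cast_eq_zero, Finset.card_eq_zero, Finset.filter_eq_empty_iff]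
        rintro x hx rfl
        exact h0 (hf x hx).missing_eq_zero
      rw [Finset.sum_congr rfl fun i _ => hall i, Finset.sum_add_distrib, hconst, hempty,
        Finset.sum_ite_eq', if_pos (Finset.mem_univ _), hh, Nat.succ_eq_add_one, hG]
      ring

end

/-! ### Raney numbers -/

theorem raney_zero (m r : ℕ) : raney 0 m (r + 1) = 1 := by
  rw [raney]
  have : ((r : ℚ) + 1) ≠ 0 := by positivity
  simp [this]

theorem raney_succ_zero (u m : ℕ) : raney (u + 1) m 0 = 0 := by simp [raney]

theorem raney_succ_succ (u m r : ℕ) :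
    raney (u + 1) m (r + 1) = raney (u + 1) m r + raney u m (r + 1 + m) := by
  have e1 : (u + 1) * (m + 1) + (r + 1) = ((u + 1) * (m + 1) + r) + 1 := by ring
  have e2 : u * (m + 1) + (r + 1 + m) = (u + 1) * (m + 1) + r := by ring
  rw [raney, raney, raney, e1, e2]
  obtain ⟨N, hN⟩ : ∃ N, (u + 1) * (m + 1) + r = N := ⟨_, rfl⟩
  rw [hN]
  have hNpos : 0 < N := by rw [← hN]; positivity
  have huN : u ≤ N := by rw [← hN]; nlinarith [Nat.zero_le (u * m)]
  have hchoose : ((N.choose (u + 1) : ℕ) : ℚ) * (u + 1) = N.choose u * (N - u) := by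
    have := Nat.choose_succ_right_eq N u
    rw [← Nat.cast_sub huN]
    exact_mod_cast this
  have hchoose' : (((N + 1).choose (u + 1) : ℕ) : ℚ) * (u + 1) = (N + 1) * N.choose u := by
    have := Nat.add_one_mul_choose_eq N u
    exact_mod_cast this.symm
  have hNq : (N : ℚ) = (u + 1) * (m + 1) + r := by exact_mod_cast hN.symm
  have h1 : ((N.choose (u + 1) : ℕ) : ℚ) = N.choose u * (N - u) / (u + 1) := by
    rw [eq_div_iff (by positivity), hchoose]
  have h2 : (((N + 1).choose (u + 1) : ℕ) : ℚ) = (N + 1) * N.choose u / (u + 1) := by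
    rw [eq_div_iff (by positivity), hchoose']
  rw [h1, h2]
  have hN0 : (N : ℚ) ≠ 0 := by positivity
  have hN1 : (N : ℚ) + 1 ≠ 0 := by positivity
  have hu1 : (u : ℚ) + 1 ≠ 0 := by positivity
  push_cast
  field_simp
  rw [hNq]
  ring

theorem factorial_mul_raney_succ (u m r : ℕ) (h : u = 0 → r ≠ 0) :
    (u.factorial : ℚ) * raney u m (r + 1) =
      u.factorial * raney u m r + u * ((u - 1).factorial * raney (u - 1) m (r + 1 + m)) := by
  rcases u with _ | u
  · obtain ⟨s, rfl⟩ := Nat.exists_eq_succ_of_ne_zero (h rfl)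
    simp [raney_zero]
  · rw [raney_succ_succ, Nat.factorial_succ, Nat.add_sub_cancel]
    push_cast
    ring

/-! ### The number of decorated partitions -/

section

variable {n : ℕ}

/-- The non-nesting words in which each letter of `S` occurs `m + 1` times, and no other letter. -/
def blockWords (m : ℕ) (S : Finset (Fin n)) : Set (List (Fin n)) :=
  {w | NonNesting w ∧ ∀ i, w.count i = if i ∈ S then m + 1 else 0}

/-- Pairs of non-nesting words such that each letter of `S` occurs `m + 1` times in one of them and
not in the other, and no other letter occurs: the decorated partitions with label set `S`. -/
def blockPairs (m : ℕ) (S : Finset (Fin n)) : Set (List (Fin n) × List (Fin n)) :=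
  {x | NonNesting x.1 ∧ NonNesting x.2 ∧ ∀ i, if i ∈ S then
    (x.1.count i = m + 1 ∧ x.2.count i = 0) ∨ (x.1.count i = 0 ∧ x.2.count i = m + 1)
    else x.1.count i = 0 ∧ x.2.count i = 0}

theorem finite_setOf_count_le (m : ℕ) : {w : List (Fin n) | ∀ i, w.count i ≤ m + 1}.Finite := by
  refine (List.finite_length_le (Fin n) (n * (m + 1))).subset fun w hw => ?_
  rw [Set.mem_ofPred_eq, ← Multiset.coe_card, ← Multiset.toFinset_sum_count_eq]
  refine (Finset.sum_le_card_nsmul _ _ (m + 1) fun i _ => ?_).trans ?_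
  · rw [Multiset.coe_count]
    exact hw i
  · rw [smul_eq_mul]
    exact Nat.mul_le_mul_right _ ((Finset.card_le_univ _).trans (by simp))

theorem finite_blockWords (m : ℕ) (S : Finset (Fin n)) : (blockWords m S).Finite :=
  (finite_setOf_count_le m).subset fun w hw i => by
    rw [hw.2 i]
    split_ifs <;> omega

theorem finite_blockPairs (m : ℕ) (S : Finset (Fin n)) : (blockPairs m S).Finite := by
  refine ((finite_setOf_count_le m).prod (finite_setOf_count_le m)).subset fun x hx =>
    ⟨fun i => ?_, fun i => ?_⟩ <;>
  · have := hx.2.2 i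
    split_ifs at this <;> omega

theorem ncard_blockWords (m : ℕ) (S : Finset (Fin n)) :
    ((blockWords m S).ncard : ℚ) = S.card.factorial * raney S.card m 1 := by
  classical
  have h := card_filter_suffix (m := m) (S := S) (w := []) (finite_blockWords m S).toFinset id
    (fun w hw => ?_) (fun u => if u = 0 then 1 else 0)
    (fun h u => u.factorial * raney u m (h + 1)) (fun u => ?_) (fun h u => ?_) (fun w hw => ?_)
    extendable_nil
  · simpa [missing, unused, Set.ncard_eq_toFinset_card _ (finite_blockWords m S)] using h
  · rw [Set.Finite.mem_toFinset] at hw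
    have hS : ∀ i ∈ w, i ∈ S := fun i hi => by
      by_contra hcon
      have := hw.2 i
      rw [if_neg hcon] at this
      exact List.count_eq_zero.1 this hi
    exact ⟨hw.1, hS, fun i hi => by rw [id, hw.2 i, if_pos (hS i hi)]⟩
  · rcases u with _ | u
    · simp [raney_zero]
    · rw [factorial_mul_raney_succ _ _ _ (by simp)]
      simp [raney_succ_zero, add_comm]
  · rw [factorial_mul_raney_succ _ _ _ (by simp)]
    simp only [add_comm, add_left_comm]
  · have hiff : unused S w = 0 ↔ w ∈ blockWords m S := by
      rw [unused, Finset.card_eq_zero, Finset.sdiff_eq_empty_iff_subset]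
      constructor
      · refine fun hsub => ⟨hw.nonNesting, fun i => ?_⟩
        split_ifs with hi
        · exact hw.count_eq i (by simpa using hsub hi)
        · exact List.count_eq_zero.2 fun hi' => hi (hw.mem i hi')
      · intro hmem i hi
        have := hmem.2 i
        rw [if_pos hi] at this
        simpa using List.count_pos_iff.1 (by omega : 0 < w.count i)
    simp only [hiff, id, Finset.filter_eq', Set.Finite.mem_toFinset]
    split_ifs <;> simp

theorem ncard_blockPairs (m : ℕ) (S : Finset (Fin n)) :
    ((blockPairs m S).ncard : ℚ) = S.card.factorial * raney S.card m 2 := by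
  classical
  have h := card_filter_suffix (m := m) (S := S) (w := []) (finite_blockPairs m S).toFinset Prod.snd
    (fun x hx => ?_) (fun u => u.factorial * raney u m 1)
    (fun h u => u.factorial * raney u m (h + 2)) (fun u => ?_) (fun h u => ?_) (fun w hw => ?_)
    extendable_nil
  · simpa [missing, unused, Set.ncard_eq_toFinset_card _ (finite_blockPairs m S)] using h
  · rw [Set.Finite.mem_toFinset] at hx
    have key : ∀ i ∈ x.2, i ∈ S ∧ x.2.count i = m + 1 := fun i hi => by
      have h1 := hx.2.2 i
      have h2 := List.count_pos_iff.2 hi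
      split_ifs at h1 with hS
      · exact ⟨hS, by omega⟩
      · omega
    exact ⟨hx.2.1, fun i hi => (key i hi).1, fun i hi => (key i hi).2⟩
  · rw [zero_add, factorial_mul_raney_succ _ _ _ (by simp)]
    simp only [add_comm, Nat.reduceAdd]
  · rw [show h + 1 + 2 = (h + 2) + 1 by ring, factorial_mul_raney_succ _ _ _ (by simp),
      show h + 1 + m + 2 = h + 2 + 1 + m by ring]
  · -- The words left of a complete word `w` are those on the labels that `w` does not use.
    rw [unused, ← ncard_blockWords, Set.ncard_eq_toFinset_card _ (finite_blockWords m _)]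
    congr 1
    refine Finset.card_nbij' Prod.fst (fun l => (l, w)) ?_ ?_ ?_ ?_
    · rintro ⟨l, r⟩ hx
      simp only [Finset.coe_filter, Set.Finite.mem_toFinset, Set.mem_ofPred_eq] at hx
      obtain ⟨⟨h1, -, h3⟩, rfl⟩ := hx
      simp only [Set.Finite.coe_toFinset]
      refine ⟨h1, fun i => ?_⟩
      have := h3 i
      simp only [Finset.mem_sdiff, List.mem_toFinset] at this ⊢
      by_cases hi : i ∈ r
      · have h4 := List.count_pos_iff.2 hi
        simp only [hi, not_true, and_false, if_false]
        split_ifs at this <;> omega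
      · have h4 := List.count_eq_zero.2 hi
        simp only [hi, not_false_iff, and_true]
        split_ifs at this ⊢ <;> omega
    · intro l hl
      simp only [Set.Finite.coe_toFinset] at hl
      simp only [Finset.coe_filter, Set.Finite.mem_toFinset, Set.mem_ofPred_eq, and_true]
      refine ⟨hl.1, hw.nonNesting, fun i => ?_⟩
      have := hl.2 i
      simp only [Finset.mem_sdiff, List.mem_toFinset] at this ⊢
      by_cases hi : i ∈ w
      · have h4 := hw.count_eq i hi
        simp only [hi, not_true, and_false, if_false] at this
        simp [hw.mem i hi, this, h4]
      · have h4 := List.count_eq_zero.2 hi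
        simp only [hi, not_false_iff, and_true] at this
        split_ifs at this ⊢ <;> simp [this, h4]
    · rintro ⟨l, r⟩ hx
      simp only [Finset.coe_filter, Set.mem_ofPred_eq] at hx
      rw [← hx.2]
    · intro l _
      rfl

end

namespace DecoratedPartition

variable {n m : ℕ}

/-- The decorated partitions in which an isolated block with label `i` follows the red line
correspond to the decorated partitions with the remaining labels, by deleting that block. -/
theorem ncard_blockPairs_prefix (m : ℕ) (i : Fin n) :
    {x ∈ blockPairs m (Finset.univ : Finset (Fin n)) |
      List.replicate (m + 1) i <+: x.2}.ncard = (blockPairs m (Finset.univ.erase i)).ncard := by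
  symm
  refine Set.ncard_congr (fun x _ => (x.1, List.replicate (m + 1) i ++ x.2)) ?_ ?_ ?_
  · rintro ⟨l, r⟩ ⟨h1, h2, h3⟩
    have hi := h3 i
    simp only [Finset.mem_erase, ne_eq, not_true, Finset.mem_univ, and_true, if_false] at hi
    refine ⟨⟨h1, (nonNesting_append fun j h4 h5 => ?_).2 ⟨nonNesting_replicate i _, h2⟩,
      fun j => ?_⟩, List.prefix_append _ _⟩
    · rw [List.eq_of_mem_replicate h4] at h5
      exact List.count_eq_zero.1 hi.2 h5
    · have := h3 j
      simp only [Finset.mem_erase, Finset.mem_univ, and_true, if_true, List.count_append,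
        List.count_replicate, beq_iff_eq] at this ⊢
      by_cases hj : i = j
      · subst hj
        simp [hi]
      · simpa [hj, Ne.symm hj] using this
  · rintro ⟨l, r⟩ ⟨l', r'⟩ - - h
    simpa using h
  · rintro ⟨l, r⟩ ⟨⟨h1, h2, h3⟩, v, hv⟩
    simp only at hv
    subst hv
    refine ⟨(l, v), ⟨h1, NonNesting.of_append_right h2, fun j => ?_⟩, rfl⟩
    have := h3 j
    simp only [Finset.mem_erase, Finset.mem_univ, and_true, if_true, List.count_append,
      List.count_replicate, beq_iff_eq] at this ⊢
    by_cases hj : i = j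
    · subst hj
      simp at this ⊢
      omega
    · simpa [hj, Ne.symm hj] using this

theorem ncard_redLineLast (hn : 1 ≤ n) :
    ({D : DecoratedPartition n m | D.RedLineLast}.ncard : ℚ) =
      n.factorial * (raney n m 2 - raney (n - 1) m 2) := by
  classical
  have hfin := finite_blockPairs m (Finset.univ : Finset (Fin n))
  have hlast : {D : DecoratedPartition n m | D.RedLineLast}.ncard =
      (hfin.toFinset.filter fun x => ∀ i, ¬ List.replicate (m + 1) i <+: x.2).card := by
    rw [← Set.ncard_coe_finset]
    refine Set.ncard_congr (fun D _ => (D.left, D.right)) ?_ ?_ ?_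
    · intro D hD
      simp only [Finset.coe_filter, Set.Finite.mem_toFinset, Set.mem_ofPred_eq]
      exact ⟨⟨D.nonNesting_left, D.nonNesting_right, fun i => by simpa using D.blocks i⟩, hD⟩
    · intro D D' _ _ h
      exact ext (Prod.ext_iff.1 h).1 (Prod.ext_iff.1 h).2
    · rintro ⟨l, r⟩ hx
      simp only [Finset.coe_filter, Set.Finite.mem_toFinset, Set.mem_ofPred_eq] at hx
      obtain ⟨⟨h1, h2, h3⟩, h4⟩ := hx
      exact ⟨⟨l, r, h1, h2, fun i => by simpa using h3 i⟩, h4, rfl⟩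
  have hnot : ((hfin.toFinset.filter fun x => ¬ ∀ i, ¬ List.replicate (m + 1) i <+: x.2).card : ℚ) =
      n.factorial * raney (n - 1) m 2 := by
    have hpoint : ∀ r : List (Fin n), (if ¬ ∀ i, ¬ List.replicate (m + 1) i <+: r then 1 else 0 : ℚ) =
        ∑ i, if List.replicate (m + 1) i <+: r then 1 else 0 := by
      intro r
      by_cases h : ∃ i, List.replicate (m + 1) i <+: r
      · obtain ⟨i, hi⟩ := h
        have hj : ∀ j, List.replicate (m + 1) j <+: r ↔ j = i := by
          refine fun j => ⟨fun h => ?_, fun h => h ▸ hi⟩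
          obtain ⟨u, hu⟩ := hi
          obtain ⟨v, hv⟩ := h
          rw [← hu, List.replicate_succ, List.replicate_succ] at hv
          exact (List.cons.inj hv).1
        simp [hj]
      · push Not at h
        simp [h]
    have hcard : ∀ i : Fin n, ((hfin.toFinset.filter fun x =>
        List.replicate (m + 1) i <+: x.2).card : ℚ) = (n - 1).factorial * raney (n - 1) m 2 := by
      intro i
      have h := ncard_blockPairs m (Finset.univ.erase i)
      rw [Finset.card_erase_of_mem (Finset.mem_univ i), Finset.card_fin,
        ← ncard_blockPairs_prefix] at h
      rw [← h, ← Set.ncard_coe_finset]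
      congr 2
      ext x
      simp
    have hswap : ((hfin.toFinset.filter fun x =>
        ¬ ∀ i, ¬ List.replicate (m + 1) i <+: x.2).card : ℚ) =
        ∑ i, ((hfin.toFinset.filter fun x => List.replicate (m + 1) i <+: x.2).card : ℚ) := by
      simp only [Finset.card_filter, Nat.cast_sum, Nat.cast_ite, Nat.cast_one, Nat.cast_zero]
      rw [Finset.sum_comm]
      exact Finset.sum_congr rfl fun x _ => hpoint x.2
    rw [hswap, Finset.sum_congr rfl fun i _ => hcard i, Finset.sum_const, Finset.card_fin,
      nsmul_eq_mul, ← mul_assoc, ← Nat.cast_mul, Nat.mul_factorial_pred (by omega)]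
  have hall : (hfin.toFinset.card : ℚ) = n.factorial * raney n m 2 := by
    have h := ncard_blockPairs m (Finset.univ : Finset (Fin n))
    rwa [Finset.card_fin, Set.ncard_eq_toFinset_card _ hfin] at h
  have hadd := Finset.card_filter_add_card_filter_not (s := hfin.toFinset)
    (fun x => ∀ i, ¬ List.replicate (m + 1) i <+: x.2)
  rw [hlast, mul_sub, ← hall, ← hnot, ← hadd]
  push_cast
  ring

end DecoratedPartition

theorem proposition3p8 (n m : ℕ) (hn : 1 ≤ n) (hm : 1 ≤ m) :
    Set.BijOn (DecoratedPartition.region (n := n) (m := m)) Set.univ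
        (regions (arrangementA n m)) ∧
    (∀ D D' : DecoratedPartition n m,
      DecoratedPartition.InSameRegion (arrangementB n m) D D' ↔
        D.diagram = D'.diagram ∧
        ∀ i : Fin n, D.Tangled i → (D.BeforeRedLine i ↔ D'.BeforeRedLine i)) ∧
    ((regions (arrangementB n m)).ncard : ℚ) =
      (Nat.factorial n : ℚ) * (raney n m 2 - raney (n - 1) m 2) := by
  refine ⟨DecoratedPartition.bijOn_region, DecoratedPartition.inSameRegion_iff, ?_⟩
  rw [DecoratedPartition.ncard_regions_arrangementB, DecoratedPartition.ncard_redLineLast hn]
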